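/- Let $L\ge 2$ and $M\ge 1$ be integers, and let $0=t_0\le t_1\le\dots\le t_{M-1}$ be integers (repetitions allowed) with $(L-1)\mid t_{M-1}$. Put $f_i(x)=\frac1L x+t_i$ for $i\in[M]:=\{0,\dots,M-1\}$, $f_{i_1\dots i_n}=f_{i_1}\circ\dots\circ f_{i_n}$, and $I=\bigl[0,\tfrac{L\,t_{M-1}}{L-1}\bigr]$, so that $f_i(I)\subset I$ for all $i$. Let $p\in(0,1)$. For every finite word $w$ over $[M]$ and every $k\in[M]$ toss a coin $X^{w}_k\in\{0,1\}$ with $\mathbb P(X^w_k=1)=p$, all coins being independent. Let $\mathcal E_0$ consist of the empty word, $\mathcal E_{n+1}=\{wk: w\in\mathcal E_n,\ X^w_k=1\}$, and let $\Lambda_{\mathcal F}(p)=\bigcap_{n\ge1}\bigcup_{w\in\mathcal E_n}f_w(I)$ be the coin-tossing integer self-similar set. Non-extinction is the event that some infinite word has all its finite prefixes in $\bigcup_n\mathcal E_n$. Let $S_0,\dots,S_{m-1}$ be the distinct maps among the $f_i$, and let $n_j=\#\{i\in[M]: f_i=S_j\}$ and $q_j=n_j/M$. Let $\nu$ be the image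 of the product measure $q^{\mathbb N}$ under $(i_1,i_2,\dots)\mapsto\lim_{n}S_{i_1}\circ\dots\circ S_{i_n}(0)$. Let $J^0,\dots,J^{N-1}$ be, in increasing order, the (finitely many) intervals $[jL,(j+1)L]$, $j\in\mathbb Z$, with positive $\nu$-measure, and let $J^\ell_a$, $a\in[L]:=\{0,\dots,L-1\}$, be the $L$ unit intervals, from left to right, into which $J^\ell$ subdivides. For $a\in[L]$ define the $N\times N$ matrix $A_a$ by $A_a(\ell,k)=n_i$ if $S_i(J^k)=J^\ell_a$ for some (necessarily unique) $i$, and $A_a(\ell,k)=0$ otherwise, and let $CS_{a,U}=\sum_{\ell=0}^{N-1}A_a(\ell,U)$ be its column sums. Theorem. Suppose that 1. $p^L\prod_{a=0}^{L-1}CS_{a,U}>1$ for every $U\in[N]$ (that is, $p$ exceeds the reciprocal of the geometric mean over $a$ of the $U$-th column sums, for every column $U$), and 2. for every $b\in[L]$ there is $U\in[N]$ with $A_b(U,V)>0$ for all $V\in[N]$. Then non-extinction has positive probability and, conditioned on non-extinction, $\Lambda_{\mathcal F}(p)$ has positive Lebesgue measure almost surely. -/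

import Mathlib

open MeasureTheory

/-- An integer self-similar iterated function system on the line: the maps
`f_i(x) = x / L + t_i`, `i = 0, …, M - 1`, with `L ≥ 2`, translations
`0 = t_0 ≤ t_1 ≤ ⋯ ≤ t_{M-1}` in `ℕ` (repetitions allowed) and `L - 1 ∣ t_{M-1}`. -/
structure IntegerIFS where
  /-- the reciprocal of the common contraction ratio -/
  L : ℕ
  /-- the number of maps, counted with repetition -/
  M : ℕ
  /-- the translations -/
  t : Fin M → ℕ
  two_le_L : 2 ≤ L
  M_pos : 0 < M
  t_zero : t ⟨0, M_pos⟩ = 0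
  t_mono : Monotone t
  dvd_t_last : (L - 1) ∣ t ⟨M - 1, Nat.sub_lt M_pos Nat.one_pos⟩

/-- For a family of maps `g` and a word `w = i_1 … i_n`, the composition
`g_{i_1} ∘ ⋯ ∘ g_{i_n}`. -/
def wordMap {ι : Type*} (g : ι → ℝ → ℝ) : List ι → ℝ → ℝ
  | [] => id
  | i :: w => g i ∘ wordMap g w

/-- The prefix of length `n` of an infinite sequence. -/
def seqPrefix {ι : Type*} (i : ℕ → ι) (n : ℕ) : List ι :=
  List.ofFn fun k : Fin n => i k

namespace IntegerIFS

variable (F : IntegerIFS)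

/-- The maps `f_i` of the system. -/
noncomputable def map (i : Fin F.M) (x : ℝ) : ℝ := x / F.L + F.t i

/-- The interval spanned by the attractor, `I = [0, L t_{M-1} / (L - 1)]`; each `f_i` maps it
into itself. -/
noncomputable def spanInterval : Set ℝ :=
  Set.Icc 0 ((F.L : ℝ) * F.t ⟨F.M - 1, Nat.sub_lt F.M_pos Nat.one_pos⟩ / ((F.L : ℝ) - 1))

/-! ### The random set -/

/-- The sample space: a subset of `[M]` (encoded by its indicator) at every node of the
`M`-ary tree of finite words. -/
abbrev Sample : Type := List (Fin F.M) → Fin F.M → Bool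

/-- The law of the coin tosses: all the coins, one for each node `w` and each `k ∈ [M]`, are
independent, and each lands on head (`true`) with probability `p`. -/
noncomputable def law (p : unitInterval) : Measure F.Sample :=
  Measure.infinitePi fun _ : List (Fin F.M) =>
    Measure.pi fun _ : Fin F.M => ProbabilityTheory.bernoulliMeasure true false p

/-- The random set `X_n ⊆ [M]^n` of retained words of length `n`: `X_0` consists of the empty
word, and `X_{n+1}` of the words `wk` with `w ∈ X_n` for which the coin `k` at the node `w`
lands on head. -/
def retained (ω : F.Sample) : ℕ → Set (List (Fin F.M))
  | 0 => {[]}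
  | n + 1 => {v | ∃ w ∈ retained ω n, ∃ k, ω w k = true ∧ v = w ++ [k]}

/-- The set of infinite words all of whose prefixes are retained. -/
def survivors (ω : F.Sample) : Set (ℕ → Fin F.M) :=
  {i | ∀ n, seqPrefix i n ∈ F.retained ω n}

/-- The event of non-extinction. -/
def nonExtinction : Set F.Sample := {ω | (F.survivors ω).Nonempty}

/-- The coin tossing integer self-similar set. -/
noncomputable def randomSet (ω : F.Sample) : Set ℝ :=
  ⋂ n ≥ 1, ⋃ w ∈ F.retained ω n, wordMap F.map w '' F.spanInterval

/-! ### The distinct maps, the natural measure and the basic types -/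

/-- Labels of the distinct maps of the system: a map is determined by its translation. -/
abbrev Distinct : Type := {d : ℕ // d ∈ Finset.univ.image F.t}

/-- The distinct maps `S_d(x) = x / L + d`. -/
noncomputable def distinctMap (d : F.Distinct) (x : ℝ) : ℝ := x / F.L + (d : ℕ)

/-- The multiplicity `n_d` of the map `S_d` in the system. -/
def mult (d : F.Distinct) : ℕ := (Finset.univ.filter fun i => F.t i = d).card

/-- The probability vector `q_d = n_d / M`, as a measure on the labels. -/
noncomputable def weights : Measure F.Distinct :=
  ∑ d : F.Distinct, ((F.mult d : ENNReal) / (F.M : ENNReal)) • Measure.dirac d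

/-- The natural projection `Π(i) = lim S_{i_1 … i_n}(0)`. -/
noncomputable def natProj (i : ℕ → F.Distinct) : ℝ :=
  Filter.atTop.limUnder fun n => wordMap F.distinctMap (seqPrefix i n) 0

/-- The natural measure `ν = Π_* (q^ℕ)`. -/
noncomputable def natMeasure : Measure ℝ :=
  (Measure.infinitePi fun _ : ℕ => F.weights).map F.natProj

/-- The `L`-adic interval `[jL, (j+1)L]` of length `L`. -/
def bigInterval (j : ℤ) : Set ℝ := Set.Icc ((j : ℝ) * F.L) (((j : ℝ) + 1) * F.L)

/-- The basic types: the `L`-adic intervals `J` of length `L` with `ν(J) > 0`, recorded by the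
integers `j` with `J = [jL, (j+1)L]` (and so listed in increasing order). -/
def basicTypes : Set ℤ := {j | 0 < F.natMeasure (F.bigInterval j)}

/-- The `a`-th of the `L` unit intervals, from left to right, into which `[jL, (j+1)L]`
subdivides. -/
def unitPiece (j : ℤ) (a : Fin F.L) : Set ℝ :=
  Set.Icc ((j : ℝ) * F.L + (a : ℕ)) ((j : ℝ) * F.L + (a : ℕ) + 1)

open Classical in
/-- The matrix `A_a`: its entry at `(ℓ, k)` is the multiplicity `n_d` of the map `S_d` with
`S_d(J^k) = J^ℓ_a`, and `0` if there is no such map. (Such a map is unique.) -/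
noncomputable def mat (a : Fin F.L) : Matrix F.basicTypes F.basicTypes ℕ := fun l k =>
  if h : ∃ d : F.Distinct, F.distinctMap d '' F.bigInterval k = F.unitPiece l a then
    F.mult h.choose
  else 0

/-! ### Well-definedness -/

theorem sum_mult : ∑ d : F.Distinct, F.mult d = F.M := by
  have h := Finset.card_eq_sum_card_image F.t Finset.univ
  rw [Finset.card_univ, Fintype.card_fin] at h
  refine Eq.trans ?_ h.symm
  exact Finset.sum_coe_sort (Finset.univ.image F.t)
    (fun d => (Finset.univ.filter fun i => F.t i = d).card)

instance : IsProbabilityMeasure F.weights := by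
  constructor
  have hM : (F.M : ENNReal) ≠ 0 := by exact_mod_cast F.M_pos.ne'
  simp only [weights, Measure.coe_finsetSum, Finset.sum_apply, Measure.smul_apply,
    measure_univ, smul_eq_mul, mul_one, div_eq_mul_inv]
  rw [← Finset.sum_mul, ← Nat.cast_sum, F.sum_mult]
  exact ENNReal.mul_inv_cancel hM (ENNReal.natCast_ne_top _)

instance (p : unitInterval) : IsProbabilityMeasure (F.law p) := by
  unfold law; infer_instance

theorem wordMap_seqPrefix (n : ℕ) (i : ℕ → F.Distinct) :
    wordMap F.distinctMap (seqPrefix i n) 0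
      = ∑ k ∈ Finset.range n, ((i k : ℕ) : ℝ) / (F.L : ℝ) ^ k := by
  induction n generalizing i with
  | zero => simp [seqPrefix, wordMap]
  | succ n ih =>
    have h : seqPrefix i (n + 1) = i 0 :: seqPrefix (fun k => i (k + 1)) n := by
      simp [seqPrefix, List.ofFn_succ]
    rw [h, Finset.sum_range_succ']
    simp only [wordMap, Function.comp_apply, ih, distinctMap, Finset.sum_div, pow_zero, div_one]
    congr 1
    refine Finset.sum_congr rfl fun k _ => ?_
    rw [pow_succ, div_div]

theorem exists_bound : ∃ C : ℕ, ∀ d : F.Distinct, (d : ℕ) ≤ C :=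
  ⟨(Finset.univ.image F.t).sup id, fun d => Finset.le_sup (f := id) d.2⟩

theorem summable_digits (i : ℕ → F.Distinct) :
    Summable fun k => ((i k : ℕ) : ℝ) / (F.L : ℝ) ^ k := by
  obtain ⟨C, hC⟩ := F.exists_bound
  have hL : (2 : ℝ) ≤ F.L := by exact_mod_cast F.two_le_L
  have hg : Summable fun k : ℕ => (C : ℝ) * (1 / (F.L : ℝ)) ^ k :=
    (summable_geometric_of_lt_one (by positivity)
      (by rw [div_lt_one (by linarith)]; linarith)).mul_left _
  refine Summable.of_nonneg_of_le (fun k => by positivity) (fun k => ?_) hg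
  rw [one_div, inv_pow, ← div_eq_mul_inv]
  have : ((i k : ℕ) : ℝ) ≤ C := by exact_mod_cast hC (i k)
  gcongr

/-- The limit that defines the natural projection exists, and it is the sum of the series
`∑ t_{i_k} L^{-k}`. -/
theorem natProj_eq_tsum (i : ℕ → F.Distinct) :
    F.natProj i = ∑' k, ((i k : ℕ) : ℝ) / (F.L : ℝ) ^ k := by
  unfold natProj
  simp only [wordMap_seqPrefix]
  exact (F.summable_digits i).hasSum.tendsto_sum_nat.limUnder_eq

theorem exists_natProj_mem : ∃ C : ℕ, ∀ i, F.natProj i ∈ Set.Icc (0 : ℝ) C := by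
  obtain ⟨C, hC⟩ := F.exists_bound
  have hL : (2 : ℝ) ≤ F.L := by exact_mod_cast F.two_le_L
  refine ⟨2 * C, fun i => ?_⟩
  rw [natProj_eq_tsum]
  refine ⟨tsum_nonneg fun k => by positivity, ?_⟩
  have hg : HasSum (fun k : ℕ => (C : ℝ) * (1 / 2 : ℝ) ^ k) (C * 2) :=
    hasSum_geometric_two.mul_left _
  have hle := (F.summable_digits i).tsum_le_tsum (g := fun k : ℕ => (C : ℝ) * (1 / 2 : ℝ) ^ k)
    (fun k => ?_) hg.summable
  · rw [hg.tsum_eq] at hle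
    push_cast
    linarith
  · rw [one_div, inv_pow, ← div_eq_mul_inv]
    have : ((i k : ℕ) : ℝ) ≤ C := by exact_mod_cast hC (i k)
    gcongr

theorem measurable_natProj : Measurable F.natProj := by
  refine measurable_of_tendsto_metrizable
    (f := fun n i => ∑ k ∈ Finset.range n, ((i k : ℕ) : ℝ) / (F.L : ℝ) ^ k)
    (fun n => ?_) ?_
  · refine Finset.measurable_sum _ fun k _ => ?_
    exact ((measurable_of_countable fun d : F.Distinct => ((d : ℕ) : ℝ) / (F.L : ℝ) ^ k).comp
      (measurable_pi_apply k))
  · rw [tendsto_pi_nhds]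
    intro i
    rw [natProj_eq_tsum]
    exact (F.summable_digits i).hasSum.tendsto_sum_nat

/-- There are only finitely many basic types. -/
theorem finite_basicTypes : F.basicTypes.Finite := by
  obtain ⟨C, hC⟩ := F.exists_natProj_mem
  have hL : (2 : ℝ) ≤ F.L := by exact_mod_cast F.two_le_L
  refine (Set.finite_Icc (-1 : ℤ) C).subset fun j hj => ?_
  have hpos : 0 < F.natMeasure (F.bigInterval j) := hj
  rw [bigInterval, natMeasure, Measure.map_apply F.measurable_natProj measurableSet_Icc] at hpos
  obtain ⟨i, hi⟩ := nonempty_of_measure_ne_zero hpos.ne'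
  obtain ⟨h1, h2⟩ := hi
  obtain ⟨h3, h4⟩ := hC i
  constructor
  · have : (0 : ℝ) ≤ (j : ℝ) + 1 := by
      by_contra hneg
      push Not at hneg
      nlinarith
    have : (0 : ℤ) ≤ j + 1 := by exact_mod_cast this
    linarith
  · rcases le_or_gt j 0 with h | h
    · exact h.trans (by positivity)
    · have hj0 : (0 : ℝ) < j := by exact_mod_cast h
      have : (j : ℝ) ≤ C := by nlinarith
      exact_mod_cast this

noncomputable instance : Fintype F.basicTypes := F.finite_basicTypes.fintype

/-- The `k`-th column sum of the matrix `A_a`. -/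
noncomputable def colSum (a : Fin F.L) (k : F.basicTypes) : ℕ := ∑ l, F.mat a l k

end IntegerIFS

/-! The random set is studied through digit addresses. Fix a basic type `V`. A number `c < L ^ n`,
read as `n` digits in base `L`, names a position of generation `n`, and `words n c V` collects the
words carrying `J^V` to that position in some basic interval. Let `u = expCount p n c V` be the
expected number of retained ones. Appending a digit `a` multiplies this count, on average, by `p *
colSum a V`. Condition 1 says that the geometric mean of these factors over `a` exceeds 1. Hence for
small `θ > 0` the sum over `a` of their powers `-θ` is at most some `r < L`, uniformly in `V`, and
by Jensen the average of `u ^ (-θ)` over all addresses is at most `(r / L) ^ n`.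

Two words share exactly the coins of their common prefix. Grouping pairs by their splitting
generation bounds the second moment by `u ^ 2 * energy`, where `energy` adds up reciprocals of
earlier expected counts. The preceding decay bounds the average of `energy ^ θ`, hence bounds the
average of `energy⁻¹` below by some `δ > 0`. By the second moment method an address is hit with
probability at least `energy⁻¹`, so at every generation the expected proportion of hit addresses is
at least `δ`. Different addresses occupy disjoint intervals of equal length, so this proportion
bounds the volume of the compact approximations from below. If the limit set were almost surely
null, the proportions would tend to 0 almost surely, against dominated convergence: this is
`not_ae_volume_randomSet_eq_zero`.

A branching argument upgrades positive probability to almost sure positivity given survival. With `g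
x = (1 - p + p * x) ^ M`, the extinction probability `x` satisfies `g x ≤ x`, the probability `y` of
a null set satisfies `y ≤ g y`, and `x ≤ y < 1`. Convexity of `g` and `g 1 = 1` force `x = y`
(`eq_of_binomial_fixedPoint`). -/

/-! ### Inequalities for real powers and sums over digits -/

/-- Jensen's inequality for the convex function `x ↦ x ^ (-θ)`. -/
theorem Real.rpow_neg_arith_mean_le {ι : Type*} (s : Finset ι) (w z : ι → ℝ) {θ : ℝ}
    (hθ : 0 ≤ θ) (hw : ∀ i ∈ s, 0 ≤ w i) (hw1 : ∑ i ∈ s, w i = 1) (hz : ∀ i ∈ s, 0 < z i) :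
    (∑ i ∈ s, w i * z i) ^ (-θ) ≤ ∑ i ∈ s, w i * z i ^ (-θ) := by
  -- AM-GM is used twice: for `z`, where the negative exponent reverses it, and for `z ^ (-θ)`. The
  -- two geometric means agree.
  have h1 := Real.geom_mean_le_arith_mean_weighted s w z hw hw1 fun i hi => (hz i hi).le
  have h2 := Real.geom_mean_le_arith_mean_weighted s w (fun i => z i ^ (-θ)) hw hw1
    fun i hi => (Real.rpow_pos_of_pos (hz i hi) _).le
  have h0 : 0 < ∏ i ∈ s, z i ^ w i := Finset.prod_pos fun i hi => Real.rpow_pos_of_pos (hz i hi) _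
  refine (Real.rpow_le_rpow_of_nonpos h0 h1 (by linarith)).trans (le_trans (le_of_eq ?_) h2)
  rw [← Real.finsetProd_rpow _ _ fun i hi => (Real.rpow_pos_of_pos (hz i hi) _).le]
  refine Finset.prod_congr rfl fun i hi => ?_
  rw [← Real.rpow_mul (hz i hi).le, ← Real.rpow_mul (hz i hi).le, mul_comm]

theorem Real.rpow_sum_le_sum_rpow_of_le_one {ι : Type*} (s : Finset ι) (f : ι → ℝ) {θ : ℝ}
    (hθ : 0 < θ) (hθ1 : θ ≤ 1) (hf : ∀ i ∈ s, 0 ≤ f i) :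
    (∑ i ∈ s, f i) ^ θ ≤ ∑ i ∈ s, f i ^ θ := by
  classical
  induction s using Finset.induction_on with
  | empty => simp [Real.zero_rpow hθ.ne']
  | insert a s ha ih =>
    rw [Finset.sum_insert ha, Finset.sum_insert ha]
    have h := ih fun i hi => hf i (Finset.mem_insert_of_mem hi)
    refine (Real.rpow_add_le_add_rpow (hf a (Finset.mem_insert_self _ _))
      (Finset.sum_nonneg fun i hi => hf i (Finset.mem_insert_of_mem hi)) hθ.le hθ1).trans ?_
    linarith

/-- Splits an address into its parent's address `c / L` and its last digit `c % L`. -/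
theorem Finset.sum_range_mul_eq {β : Type*} [AddCommMonoid β] (L m : ℕ) (hL : 0 < L)
    (g : ℕ → ℕ → β) :
    ∑ c ∈ Finset.range (L * m), g (c / L) (c % L)
      = ∑ a : Fin L, ∑ c ∈ Finset.range m, g c a := by
  rw [Finset.sum_comm]
  induction m with
  | zero => simp
  | succ m ih =>
    rw [Nat.mul_succ, Finset.sum_range_add, Finset.sum_range_succ, ih, ← Fin.sum_univ_eq_sum_range
      (fun x => g ((L * m + x) / L) ((L * m + x) % L)) L]
    congr 1
    refine Finset.sum_congr rfl fun a _ => ?_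
    rw [Nat.mul_add_mod, Nat.mod_eq_of_lt a.2, Nat.mul_add_div hL, Nat.div_eq_of_lt a.2, add_zero]

/-- If the geometric mean of `L` positive numbers exceeds `1`, then so do their power means with
small negative exponents. -/
theorem eventually_sum_rpow_neg_lt {L : ℕ} (y : Fin L → ℝ) (hy : ∀ a, 0 < y a)
    (h : 1 < ∏ a, y a) :
    ∀ᶠ θ in nhdsWithin (0 : ℝ) (Set.Ioi 0), ∑ a, y a ^ (-θ) < L := by
  -- At `θ = 0` the sum equals `L`, and its derivative there is minus the logarithm of the product,
  -- hence negative.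
  have hd : HasDerivAt (fun θ : ℝ => ∑ a, y a ^ (-θ)) (∑ a, -Real.log (y a)) 0 := by
    refine HasDerivAt.fun_sum fun a _ => ?_
    have := (hasDerivAt_neg (0 : ℝ)).const_rpow (hy a)
    simpa using this
  have hneg : ∑ a, -Real.log (y a) < 0 := by
    rw [Finset.sum_neg_distrib, ← Real.log_prod fun a _ => (hy a).ne']
    linarith [Real.log_pos h]
  have h1 := (hasDerivWithinAt_iff_tendsto_slope' (by simp)).1
    (hd.hasDerivWithinAt (s := Set.Ioi 0))
  filter_upwards [h1.eventually (gt_mem_nhds hneg), self_mem_nhdsWithin] with θ hθ hpos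
  rw [slope_def_field, sub_zero, div_lt_iff₀ (by simpa using hpos)] at hθ
  simp at hθ
  linarith

/-! ### Words sorted by address, and their expected counts -/

namespace IntegerIFS

variable (F : IntegerIFS)

theorem L_pos : 0 < F.L := by have := F.two_le_L; omega

theorem one_lt_L_real : (1 : ℝ) < F.L := by
  have := F.two_le_L
  exact_mod_cast (by omega : 1 < F.L)

theorem distinctMap_image_eq_iff (d : F.Distinct) (k l : ℤ) (a : Fin F.L) :
    F.distinctMap d '' F.bigInterval k = F.unitPiece l a ↔
      ((d : ℕ) : ℤ) + k = l * F.L + (a : ℕ) := by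
  have hL : (0 : ℝ) < F.L := by exact_mod_cast F.L_pos
  have him : F.distinctMap d '' F.bigInterval k
      = Set.Icc (((d : ℕ) : ℝ) + k) (((d : ℕ) : ℝ) + k + 1) := by
    ext x
    simp only [distinctMap, bigInterval, Set.mem_image, Set.mem_Icc]
    constructor
    · rintro ⟨y, ⟨h1, h2⟩, rfl⟩
      have h3 : (k : ℝ) ≤ y / F.L := by rwa [le_div_iff₀ hL]
      have h4 : y / F.L ≤ k + 1 := by rwa [div_le_iff₀ hL]
      constructor <;> linarith
    · rintro ⟨h1, h2⟩
      refine ⟨(x - d) * F.L, ⟨?_, ?_⟩, ?_⟩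
      · gcongr; linarith
      · gcongr; linarith
      · field_simp; ring
  rw [him, unitPiece]
  constructor
  · intro h
    have h1 := congrArg sInf h
    rw [csInf_Icc (by linarith), csInf_Icc (by linarith)] at h1
    exact_mod_cast h1
  · intro h
    have : ((d : ℕ) : ℝ) + k = l * F.L + (a : ℕ) := by exact_mod_cast h
    rw [this]

/-- Passes from distinct maps back to labels, since each label carries its own coin. -/
theorem mat_eq_card (a : Fin F.L) (l k : F.basicTypes) :
    F.mat a l k = (Finset.univ.filter fun i : Fin F.M =>
      (F.t i : ℤ) + k = (l : ℤ) * F.L + (a : ℕ)).card := by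
  unfold mat
  split_ifs with h
  · have h1 := (F.distinctMap_image_eq_iff _ _ _ _).1 h.choose_spec
    unfold mult
    congr 1
    refine Finset.filter_congr fun i _ => ?_
    omega
  · symm
    rw [Finset.card_eq_zero, Finset.filter_eq_empty_iff]
    intro i _ hi
    exact h ⟨⟨F.t i, Finset.mem_image_of_mem _ (Finset.mem_univ _)⟩,
      (F.distinctMap_image_eq_iff _ _ _ _).2 hi⟩

/-- The pairs of a basic type `k` and a label `i` such that `f_i(J^V)` is the `a`-th unit piece
of `J^k`. -/
noncomputable def steps (a : ℕ) (V : F.basicTypes) : Finset (F.basicTypes × Fin F.M) :=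
  Finset.univ.filter fun x => (F.t x.2 : ℤ) + V = (x.1 : ℤ) * F.L + a

theorem mem_steps {a : ℕ} {V : F.basicTypes} {x : F.basicTypes × Fin F.M} :
    x ∈ F.steps a V ↔ (F.t x.2 : ℤ) + V = (x.1 : ℤ) * F.L + a := by
  simp [steps]

theorem card_steps (a : Fin F.L) (V : F.basicTypes) : (F.steps a V).card = F.colSum a V := by
  rw [steps, Finset.card_filter, Fintype.sum_prod_type, colSum]
  refine Finset.sum_congr rfl fun l _ => ?_
  rw [mat_eq_card, Finset.card_filter]

/-- The words `w` of length `n` for which `f_w(J^V)` is the piece with address `c` of one of the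
basic intervals, where all the intermediate pieces are of basic type. -/
noncomputable def words : ℕ → ℕ → F.basicTypes → Finset (List (Fin F.M))
  | 0, _, _ => {[]}
  | n + 1, c, V => (F.steps (c % F.L) V).biUnion fun x =>
      (words n (c / F.L) x.1).image fun w => w ++ [x.2]

/-- The union defining `words` is disjoint: the last letter, the last digit and `V` determine the
parent type. -/
theorem sum_words_succ {β : Type*} [AddCommMonoid β] (n c : ℕ) (V : F.basicTypes)
    (g : List (Fin F.M) → β) :
    ∑ w ∈ F.words (n + 1) c V, g w
      = ∑ x ∈ F.steps (c % F.L) V, ∑ w ∈ F.words n (c / F.L) x.1, g (w ++ [x.2]) := by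
  rw [words, Finset.sum_biUnion]
  · refine Finset.sum_congr rfl fun x _ => ?_
    rw [Finset.sum_image]
    intro w _ w' _ h
    exact List.append_cancel_right h
  · intro x hx y hy hxy
    rw [Function.onFun, Finset.disjoint_left]
    intro w hw hw'
    obtain ⟨v, _, rfl⟩ := Finset.mem_image.1 hw
    obtain ⟨v', _, h⟩ := Finset.mem_image.1 hw'
    have h2 : y.2 = x.2 := by simpa using (List.append_inj' h rfl).2
    have hx1 := F.mem_steps.1 hx
    have hy1 := F.mem_steps.1 hy
    rw [h2] at hy1
    have hL : (F.L : ℤ) ≠ 0 := by exact_mod_cast F.L_pos.ne'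
    have h3 : (x.1 : ℤ) = y.1 := mul_right_cancel₀ hL (by linarith)
    exact hxy (Prod.ext (Subtype.ext h3) h2.symm)

theorem length_of_mem_words {n c : ℕ} {V : F.basicTypes} {w : List (Fin F.M)}
    (hw : w ∈ F.words n c V) : w.length = n := by
  induction n generalizing c V w with
  | zero => simpa [words] using hw
  | succ n ih =>
    simp only [words, Finset.mem_biUnion, Finset.mem_image] at hw
    obtain ⟨x, _, v, hv, rfl⟩ := hw
    simp [ih hv]

/-- The expected number of retained words among `words n c V`. -/
noncomputable def expCount (p : ℝ) (n c : ℕ) (V : F.basicTypes) : ℝ :=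
  p ^ n * (F.words n c V).card

theorem expCount_succ (p : ℝ) (n c : ℕ) (V : F.basicTypes) :
    F.expCount p (n + 1) c V
      = p * ∑ x ∈ F.steps (c % F.L) V, F.expCount p n (c / F.L) x.1 := by
  unfold expCount
  rw [Finset.card_eq_sum_ones, sum_words_succ, Finset.mul_sum, Nat.cast_sum, Finset.mul_sum]
  refine Finset.sum_congr rfl fun x _ => ?_
  simp only [Finset.sum_const, smul_eq_mul, mul_one]
  ring

theorem expCount_pos {p : ℝ} (hp : 0 < p) (hcs : ∀ a V, 0 < F.colSum a V) (n c : ℕ) (V : F.basicTypes) : 0 < F.expCount p n c V := by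
  induction n generalizing c V with
  | zero => simp [expCount, words]
  | succ n ih =>
    rw [expCount_succ]
    refine mul_pos hp (Finset.sum_pos (fun x _ => ih _ _) ?_)
    rw [← Finset.card_pos, F.card_steps ⟨c % F.L, Nat.mod_lt _ F.L_pos⟩]
    exact hcs _ _
-- Negative moments and energy
/-- Negative moments of the expected counts, summed over all addresses, decay geometrically
compared to the number of addresses. -/
theorem sum_expCount_rpow_neg_le {p : ℝ} (hp : 0 < p) (hcs : ∀ a V, 0 < F.colSum a V) {θ r : ℝ}
    (hθ : 0 ≤ θ) (hr : ∀ V, ∑ a, (p * F.colSum a V) ^ (-θ) ≤ r) (n : ℕ) (V : F.basicTypes) :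
    ∑ c ∈ Finset.range (F.L ^ n), F.expCount p n c V ^ (-θ) ≤ r ^ n := by
  have hpos := F.expCount_pos hp hcs
  have hr0 : 0 ≤ r := (Finset.sum_nonneg fun a _ => by positivity).trans (hr V)
  induction n generalizing V with
  | zero => simp [expCount, words]
  | succ n ih =>
    -- The recursion multiplies the uniform average over the `colSum a V` parents by `p * colSum a
    -- V`; Jensen is applied to that average.
    have key : ∀ (a : Fin F.L) (c : ℕ),
        (p * ∑ x ∈ F.steps a V, F.expCount p n c x.1) ^ (-θ)
          ≤ (p * F.colSum a V) ^ (-θ) * ∑ x ∈ F.steps a V,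
            (F.colSum a V : ℝ)⁻¹ * F.expCount p n c x.1 ^ (-θ) := by
      intro a c
      have hC : (0 : ℝ) < F.colSum a V := by exact_mod_cast hcs a V
      have h := Real.rpow_neg_arith_mean_le (F.steps a V) (fun _ => (F.colSum a V : ℝ)⁻¹)
        (fun x => F.expCount p n c x.1) hθ (fun _ _ => by positivity)
        (by rw [Finset.sum_const, card_steps, nsmul_eq_mul, mul_inv_cancel₀ hC.ne'])
        (fun x _ => hpos n c x.1)
      have h2 : p * ∑ x ∈ F.steps a V, F.expCount p n c x.1
          = (p * F.colSum a V) * ∑ x ∈ F.steps a V,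
            (F.colSum a V : ℝ)⁻¹ * F.expCount p n c x.1 := by
        rw [← Finset.mul_sum]
        field_simp
      rw [h2, Real.mul_rpow (by positivity)
        (Finset.sum_nonneg fun x _ => mul_nonneg (by positivity) (hpos n c x.1).le)]
      exact mul_le_mul_of_nonneg_left h (by positivity)
    calc ∑ c ∈ Finset.range (F.L ^ (n + 1)), F.expCount p (n + 1) c V ^ (-θ)
        = ∑ a : Fin F.L, ∑ c ∈ Finset.range (F.L ^ n),
            (p * ∑ x ∈ F.steps a V, F.expCount p n c x.1) ^ (-θ) := by
          rw [pow_succ', ← Finset.sum_range_mul_eq _ _ F.L_pos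
            (fun c a => (p * ∑ x ∈ F.steps a V, F.expCount p n c x.1) ^ (-θ))]
          simp only [expCount_succ]
      _ ≤ ∑ a : Fin F.L, ∑ c ∈ Finset.range (F.L ^ n),
            (p * F.colSum a V) ^ (-θ) * ∑ x ∈ F.steps a V,
              (F.colSum a V : ℝ)⁻¹ * F.expCount p n c x.1 ^ (-θ) :=
          Finset.sum_le_sum fun a _ => Finset.sum_le_sum fun c _ => key a c
      _ = ∑ a : Fin F.L, (p * F.colSum a V) ^ (-θ) * ∑ x ∈ F.steps a V,
            (F.colSum a V : ℝ)⁻¹ * ∑ c ∈ Finset.range (F.L ^ n),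
              F.expCount p n c x.1 ^ (-θ) := by
          refine Finset.sum_congr rfl fun a _ => ?_
          rw [← Finset.mul_sum, Finset.sum_comm]
          simp only [Finset.mul_sum]
      _ ≤ ∑ a : Fin F.L, (p * F.colSum a V) ^ (-θ) * ∑ x ∈ F.steps a V,
            (F.colSum a V : ℝ)⁻¹ * r ^ n := by
          gcongr with a _ x _
          exact ih x.1
      _ = (∑ a : Fin F.L, (p * F.colSum a V) ^ (-θ)) * r ^ n := by
          rw [Finset.sum_mul]
          refine Finset.sum_congr rfl fun a _ => ?_
          have hC : (0 : ℝ) < F.colSum a V := by exact_mod_cast hcs a V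
          rw [Finset.sum_const, card_steps, nsmul_eq_mul]
          field_simp
      _ ≤ r ^ (n + 1) := by
          rw [pow_succ']
          gcongr
          exact hr V

/-- A bound for the normalised second moment of the number of retained words among
`words n c V`. -/
noncomputable def energy (p : ℝ) : ℕ → ℕ → ℝ
  | 0, _ => 1
  | n + 1, c => energy p n (c / F.L) + p⁻¹ * ∑ V, (F.expCount p n (c / F.L) V)⁻¹

theorem one_le_energy {p : ℝ} (hp : 0 < p) (n c : ℕ) : 1 ≤ F.energy p n c := by
  induction n generalizing c with
  | zero => simp [energy]
  | succ n ih =>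
    rw [energy]
    have : 0 ≤ p⁻¹ * ∑ V, (F.expCount p n (c / F.L) V)⁻¹ :=
      mul_nonneg (by positivity) (Finset.sum_nonneg fun V _ => by unfold expCount; positivity)
    linarith [ih (c / F.L)]

/-- Since `θ ≤ 1`, taking powers is subadditive along the recursion for `energy`. After division by
the number of addresses, generation `n` contributes a multiple of `(r / L) ^ n`, so the averages are
bounded when `r < L`. -/
theorem sum_energy_rpow_le {p : ℝ} (hp : 0 < p) (hcs : ∀ a V, 0 < F.colSum a V) {θ r : ℝ}
    (hθ : 0 < θ) (hθ1 : θ ≤ 1) (hr : ∀ V, ∑ a, (p * F.colSum a V) ^ (-θ) ≤ r) (n : ℕ) :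
    ∑ c ∈ Finset.range (F.L ^ n), F.energy p n c ^ θ
      ≤ (F.L : ℝ) ^ n * (1 + p⁻¹ ^ θ * Fintype.card F.basicTypes *
          ∑ j ∈ Finset.range n, (r / F.L) ^ j) := by
  have hL : (0 : ℝ) < F.L := by exact_mod_cast F.L_pos
  have hpos := F.expCount_pos hp hcs
  induction n with
  | zero => simp [energy]
  | succ n ih =>
    have key : ∀ c, (F.energy p n c + p⁻¹ * ∑ V, (F.expCount p n c V)⁻¹) ^ θ
        ≤ F.energy p n c ^ θ + p⁻¹ ^ θ * ∑ V, F.expCount p n c V ^ (-θ) := by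
      intro c
      have h0 : ∀ V ∈ Finset.univ, 0 ≤ (F.expCount p n c V)⁻¹ :=
        fun V _ => inv_nonneg.2 (hpos n c V).le
      refine (Real.rpow_add_le_add_rpow (zero_le_one.trans (F.one_le_energy hp n c))
        (mul_nonneg (by positivity) (Finset.sum_nonneg h0)) hθ.le hθ1).trans ?_
      rw [Real.mul_rpow (by positivity) (Finset.sum_nonneg h0)]
      gcongr
      refine (Real.rpow_sum_le_sum_rpow_of_le_one _ _ hθ hθ1 h0).trans (le_of_eq ?_)
      refine Finset.sum_congr rfl fun V _ => ?_
      rw [Real.inv_rpow (hpos n c V).le, Real.rpow_neg (hpos n c V).le]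
    calc ∑ c ∈ Finset.range (F.L ^ (n + 1)), F.energy p (n + 1) c ^ θ
        = ∑ a : Fin F.L, ∑ c ∈ Finset.range (F.L ^ n),
            (F.energy p n c + p⁻¹ * ∑ V, (F.expCount p n c V)⁻¹) ^ θ := by
          rw [pow_succ', ← Finset.sum_range_mul_eq _ _ F.L_pos
            (fun c _ => (F.energy p n c + p⁻¹ * ∑ V, (F.expCount p n c V)⁻¹) ^ θ)]
          simp only [energy]
      _ = F.L * ∑ c ∈ Finset.range (F.L ^ n),
            (F.energy p n c + p⁻¹ * ∑ V, (F.expCount p n c V)⁻¹) ^ θ := by simp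
      _ ≤ F.L * ∑ c ∈ Finset.range (F.L ^ n),
            (F.energy p n c ^ θ + p⁻¹ ^ θ * ∑ V, F.expCount p n c V ^ (-θ)) := by
          gcongr with c _
          exact key c
      _ = F.L * (∑ c ∈ Finset.range (F.L ^ n), F.energy p n c ^ θ + p⁻¹ ^ θ *
            ∑ V, ∑ c ∈ Finset.range (F.L ^ n), F.expCount p n c V ^ (-θ)) := by
          rw [Finset.sum_add_distrib, ← Finset.mul_sum, Finset.sum_comm]
      _ ≤ F.L * ((F.L : ℝ) ^ n * (1 + p⁻¹ ^ θ * Fintype.card F.basicTypes *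
            ∑ j ∈ Finset.range n, (r / F.L) ^ j) + p⁻¹ ^ θ * ∑ _V : F.basicTypes, r ^ n) := by
          gcongr with V _
          exact F.sum_expCount_rpow_neg_le hp hcs hθ.le hr n V
      _ = _ := by
          rw [Finset.sum_range_succ, Finset.sum_const, Finset.card_univ, nsmul_eq_mul, div_pow]
          field_simp
          ring

/-- On average over the addresses, the reciprocal of the energy is bounded from below. -/
theorem exists_le_sum_inv_energy [Nonempty F.basicTypes] {p : ℝ} (hp : 0 < p)
    (hcol : ∀ U : F.basicTypes, 1 < p ^ F.L * ∏ a : Fin F.L, (F.colSum a U : ℝ)) :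
    ∃ δ > 0, ∀ n, δ * (F.L : ℝ) ^ n ≤ ∑ c ∈ Finset.range (F.L ^ n), (F.energy p n c)⁻¹ := by
  have hL : (0 : ℝ) < F.L := by exact_mod_cast F.L_pos
  have hcs : ∀ a V, 0 < F.colSum a V := by
    intro a V
    by_contra h
    have h0 : (F.colSum a V : ℝ) = 0 := by exact_mod_cast (by omega : F.colSum a V = 0)
    have := hcol V
    rw [Finset.prod_eq_zero (Finset.mem_univ a) h0] at this
    linarith
  obtain ⟨θ, ⟨hθr, hθ1⟩, hθ⟩ : ∃ θ : ℝ, ((∀ V, ∑ a, (p * F.colSum a V) ^ (-θ) < F.L) ∧ θ < 1) ∧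
      θ ∈ Set.Ioi (0 : ℝ) := by
    have h1 : ∀ᶠ θ in nhdsWithin (0 : ℝ) (Set.Ioi 0), ∀ V, ∑ a, (p * F.colSum a V) ^ (-θ) < F.L := by
      rw [Filter.eventually_all]
      intro V
      refine eventually_sum_rpow_neg_lt _ (fun a => ?_) ?_
      · have : (0 : ℝ) < F.colSum a V := by exact_mod_cast hcs a V
        positivity
      · simpa [Finset.prod_mul_distrib] using hcol V
    exact ((h1.and (nhdsWithin_le_nhds (gt_mem_nhds one_pos))).and self_mem_nhdsWithin).exists
  rw [Set.mem_Ioi] at hθ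
  set r := Finset.univ.sup' Finset.univ_nonempty
    fun V : F.basicTypes => ∑ a, (p * F.colSum a V) ^ (-θ) with hrdef
  have hr : ∀ V, ∑ a, (p * F.colSum a V) ^ (-θ) ≤ r := fun V =>
    Finset.le_sup' (fun V : F.basicTypes => ∑ a, (p * F.colSum a V) ^ (-θ)) (Finset.mem_univ V)
  have hrL : r < F.L := (Finset.sup'_lt_iff _).2 fun V _ => hθr V
  have hr0 : 0 ≤ r :=
    (Finset.sum_nonneg fun a _ => by positivity).trans (hr (Classical.arbitrary _))
  have hq1 : r / F.L < 1 := (div_lt_one hL).2 hrL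
  have hq0 : 0 ≤ r / F.L := by positivity
  set K := 1 + p⁻¹ ^ θ * Fintype.card F.basicTypes * (1 - r / F.L)⁻¹ with hK
  have hK0 : 0 < K := by
    have : 0 < 1 - r / F.L := by linarith
    positivity
  have hpow : ∀ n, ∑ c ∈ Finset.range (F.L ^ n), F.energy p n c ^ θ ≤ (F.L : ℝ) ^ n * K := by
    intro n
    refine (F.sum_energy_rpow_le hp hcs hθ hθ1.le hr n).trans ?_
    rw [hK, ← tsum_geometric_of_lt_one hq0 hq1]
    gcongr
    exact (summable_geometric_of_lt_one hq0 hq1).sum_le_tsum _ fun j _ => by positivity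
  refine ⟨K ^ (-θ⁻¹), by positivity, fun n => ?_⟩
  have hE : ∀ c, 0 < F.energy p n c := fun c => one_pos.trans_le (F.one_le_energy hp n c)
  have hLn : (0 : ℝ) < (F.L : ℝ) ^ n := by positivity
  -- Jensen with exponent `-θ⁻¹` turns the upper bound `K` for the average of `energy ^ θ` into a
  -- lower bound for the average of `energy⁻¹`.
  have hJ := Real.rpow_neg_arith_mean_le (Finset.range (F.L ^ n)) (fun _ => ((F.L : ℝ) ^ n)⁻¹)
    (fun c => F.energy p n c ^ θ) (inv_nonneg.2 hθ.le) (fun _ _ => by positivity)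
    (by simp [hLn.ne']) (fun c _ => Real.rpow_pos_of_pos (hE c) _)
  have hid : ∀ c, (F.energy p n c ^ θ) ^ (-θ⁻¹) = (F.energy p n c)⁻¹ := by
    intro c
    rw [← Real.rpow_mul (hE c).le, mul_neg, mul_inv_cancel₀ hθ.ne', Real.rpow_neg_one]
  simp only [hid] at hJ
  rw [← Finset.mul_sum, ← Finset.mul_sum] at hJ
  have hpos : 0 < ((F.L : ℝ) ^ n)⁻¹ * ∑ c ∈ Finset.range (F.L ^ n), F.energy p n c ^ θ := by
    refine mul_pos (by positivity) (Finset.sum_pos (fun c _ => Real.rpow_pos_of_pos (hE c) _) ?_)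
    simp [F.L_pos.ne']
  have hmono : K ^ (-θ⁻¹) ≤
      (((F.L : ℝ) ^ n)⁻¹ * ∑ c ∈ Finset.range (F.L ^ n), F.energy p n c ^ θ) ^ (-θ⁻¹) := by
    refine Real.rpow_le_rpow_of_nonpos hpos ?_ (by simpa using hθ.le)
    rw [inv_mul_le_iff₀ hLn]
    exact hpow n
  have := hmono.trans hJ
  rwa [inv_mul_eq_div, le_div_iff₀ hLn] at this

/-! ### The coins along a word -/

/-- The coins `(v, i)` met along the reversal of a word. -/
def coinsAux : List (Fin F.M) → Finset (List (Fin F.M) × Fin F.M)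
  | [] => ∅
  | i :: w => insert (w.reverse, i) (coinsAux w)

/-- The coins `(v, i)` with `vi` a prefix of `w`. -/
def coins (w : List (Fin F.M)) : Finset (List (Fin F.M) × Fin F.M) := F.coinsAux w.reverse

@[simp] theorem coins_nil : F.coins [] = ∅ := rfl

@[simp] theorem coins_append_singleton (w : List (Fin F.M)) (i : Fin F.M) :
    F.coins (w ++ [i]) = insert (w, i) (F.coins w) := by
  simp [coins, coinsAux]

theorem length_lt_of_mem_coins {w : List (Fin F.M)} {x : List (Fin F.M) × Fin F.M}
    (hx : x ∈ F.coins w) : x.1.length < w.length := by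
  induction w using List.reverseRecOn with
  | nil => simp at hx
  | append_singleton w i ih =>
    rw [coins_append_singleton, Finset.mem_insert] at hx
    rcases hx with rfl | hx
    · simp
    · have := ih hx
      simp; omega

theorem card_coins (w : List (Fin F.M)) : (F.coins w).card = w.length := by
  induction w using List.reverseRecOn with
  | nil => simp
  | append_singleton w i ih =>
    rw [coins_append_singleton, Finset.card_insert_of_notMem, ih]
    · simp
    · exact fun h => lt_irrefl _ (F.length_lt_of_mem_coins h)

theorem mem_retained_iff (ω : F.Sample) (n : ℕ) (w : List (Fin F.M)) :
    w ∈ F.retained ω n ↔ w.length = n ∧ ∀ x ∈ F.coins w, ω x.1 x.2 = true := by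
  induction n generalizing w with
  | zero =>
    simp only [retained, Set.mem_singleton_iff, List.length_eq_zero_iff]
    constructor
    · rintro rfl; simp
    · exact fun h => h.1
  | succ n ih =>
    simp only [retained, Set.mem_ofPred_eq]
    constructor
    · rintro ⟨v, hv, k, hk, rfl⟩
      obtain ⟨h1, h2⟩ := (ih v).1 hv
      refine ⟨by simp [h1], fun x hx => ?_⟩
      rw [coins_append_singleton, Finset.mem_insert] at hx
      rcases hx with rfl | hx
      · exact hk
      · exact h2 x hx
    · rintro ⟨h1, h2⟩
      rcases List.eq_nil_or_concat w with rfl | ⟨v, k, rfl⟩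
      · simp at h1
      · rw [List.concat_eq_append] at *
        rw [coins_append_singleton] at h2
        refine ⟨v, (ih v).2 ⟨by simpa using h1, fun x hx => h2 x (Finset.mem_insert_of_mem hx)⟩,
          k, h2 _ (Finset.mem_insert_self _ _), rfl⟩

/-! ### Second moment of the number of retained words -/

/-- The second moment of the number of retained words is controlled by the energy. -/
theorem sum_pow_card_coins_le {p : ℝ} (hp : 0 < p) (hp1 : p ≤ 1)
    (hcs : ∀ a V, 0 < F.colSum a V) (n c : ℕ) (V V' : F.basicTypes) :
    ∑ w ∈ F.words n c V, ∑ w' ∈ F.words n c V', p ^ (F.coins w ∪ F.coins w').card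
      ≤ F.expCount p n c V * F.expCount p n c V' * F.energy p n c := by
  have hpos := F.expCount_pos hp hcs
  induction n generalizing c V V' with
  | zero => simp [words, expCount, energy]
  | succ n ih =>
    obtain ⟨c', hc'⟩ : ∃ c', c' = c / F.L := ⟨_, rfl⟩
    -- For `w ≠ w'` the two final coins are new and distinct, giving a factor `p ^ 2`. For `w = w'`
    -- the `n + 1` coins of one word suffice.
    have hstep : ∀ {k k' : F.basicTypes} (i i' : Fin F.M), ∀ w ∈ F.words n c' k,
        ∀ w' ∈ F.words n c' k', p ^ (F.coins (w ++ [i]) ∪ F.coins (w' ++ [i'])).card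
          ≤ p ^ 2 * p ^ (F.coins w ∪ F.coins w').card + if w = w' then p ^ (n + 1) else 0 := by
      intro k k' i i' w hw w' hw'
      have hl := F.length_of_mem_words hw
      have hl' := F.length_of_mem_words hw'
      rw [coins_append_singleton, coins_append_singleton]
      split_ifs with h
      · have : n + 1 ≤ (insert (w, i) (F.coins w) ∪ insert (w', i') (F.coins w')).card := by
          rw [← hl, ← F.card_coins w, ← Finset.card_insert_of_notMem (a := (w, i))
            (fun h => lt_irrefl _ (F.length_lt_of_mem_coins h))]
          exact Finset.card_le_card Finset.subset_union_left
        have h1 := pow_le_pow_of_le_one hp.le hp1 this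
        have h2 : 0 ≤ p ^ 2 * p ^ (F.coins w ∪ F.coins w').card := by positivity
        linarith
      · rw [Finset.insert_union, Finset.union_insert, Finset.card_insert_of_notMem,
          Finset.card_insert_of_notMem]
        · exact le_of_eq (by ring)
        · intro hm
          rcases Finset.mem_union.1 hm with hm | hm
          · have := F.length_lt_of_mem_coins hm; simp at this; omega
          · have := F.length_lt_of_mem_coins hm; simp at this
        · intro hm
          rcases Finset.mem_insert.1 hm with hm | hm
          · exact h (congrArg Prod.fst hm)
          rcases Finset.mem_union.1 hm with hm | hm
          · have := F.length_lt_of_mem_coins hm; simp at this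
          · have := F.length_lt_of_mem_coins hm; simp at this; omega
    obtain ⟨X, hX⟩ : ∃ X, X = ∑ V, (F.expCount p n c' V)⁻¹ := ⟨_, rfl⟩
    have hpair : ∀ k k' : F.basicTypes, ∑ w ∈ F.words n c' k, ∑ w' ∈ F.words n c' k',
        (p ^ 2 * p ^ (F.coins w ∪ F.coins w').card + if w = w' then p ^ (n + 1) else 0)
          ≤ p ^ 2 * (F.expCount p n c' k * F.expCount p n c' k' *
            (F.energy p n c' + p⁻¹ * X)) := by
      intro k k'
      simp only [Finset.sum_add_distrib, ← Finset.mul_sum]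
      have h1 : ∑ w ∈ F.words n c' k, ∑ w' ∈ F.words n c' k', (if w = w' then p ^ (n + 1) else 0)
          ≤ p * F.expCount p n c' k := by
        have : p * F.expCount p n c' k = ∑ w ∈ F.words n c' k, p ^ (n + 1) := by
          rw [Finset.sum_const, nsmul_eq_mul, expCount]; ring
        rw [this]
        refine Finset.sum_le_sum fun w _ => ?_
        rw [Finset.sum_ite_eq]
        split_ifs
        · exact le_rfl
        · positivity
      -- This inserts the missing factor `expCount p n c' k'` into the diagonal term; summing over
      -- all types makes `X` independent of `k'`.
      have h2 : 1 ≤ F.expCount p n c' k' * X := by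
        rw [hX, ← mul_inv_cancel₀ (hpos n c' k').ne']
        refine mul_le_mul_of_nonneg_left ?_ (hpos n c' k').le
        exact Finset.single_le_sum (f := fun V => (F.expCount p n c' V)⁻¹)
          (fun V _ => inv_nonneg.2 (hpos n c' V).le) (Finset.mem_univ k')
      have h3 : p * F.expCount p n c' k ≤ p * F.expCount p n c' k * (F.expCount p n c' k' * X) :=
        le_mul_of_one_le_right (mul_nonneg hp.le (hpos n c' k).le) h2
      have h4 := mul_le_mul_of_nonneg_left (ih c' k k') (sq_nonneg p)
      have h5 : p ^ 2 * (F.expCount p n c' k * F.expCount p n c' k' *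
            (F.energy p n c' + p⁻¹ * X)) = p ^ 2 * (F.expCount p n c' k * F.expCount p n c' k' *
            F.energy p n c') + p * F.expCount p n c' k * (F.expCount p n c' k' * X) := by
        field_simp
      rw [h5]
      linarith
    rw [sum_words_succ]
    simp only [sum_words_succ]
    rw [expCount_succ, expCount_succ, energy, ← hc', ← hX]
    calc _ = ∑ x ∈ F.steps (c % F.L) V, ∑ y ∈ F.steps (c % F.L) V',
          ∑ w ∈ F.words n c' x.1, ∑ w' ∈ F.words n c' y.1,
            p ^ (F.coins (w ++ [x.2]) ∪ F.coins (w' ++ [y.2])).card := by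
          refine Finset.sum_congr rfl fun x _ => ?_
          rw [Finset.sum_comm]
      _ ≤ ∑ x ∈ F.steps (c % F.L) V, ∑ y ∈ F.steps (c % F.L) V',
          p ^ 2 * (F.expCount p n c' x.1 * F.expCount p n c' y.1 *
            (F.energy p n c' + p⁻¹ * X)) := by
          refine Finset.sum_le_sum fun x _ => Finset.sum_le_sum fun y _ => ?_
          refine le_trans ?_ (hpair x.1 y.1)
          exact Finset.sum_le_sum fun w hw => Finset.sum_le_sum fun w' hw' =>
            hstep x.2 y.2 w hw w' hw'
      _ = _ := by
          rw [mul_mul_mul_comm, Finset.sum_mul_sum, Finset.mul_sum, Finset.sum_mul]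
          refine Finset.sum_congr rfl fun x _ => ?_
          rw [Finset.mul_sum, Finset.sum_mul]
          refine Finset.sum_congr rfl fun y _ => ?_
          ring

/-! ### Survival of prescribed words -/

/-- The event that all the coins in a finite set land on head. -/
def allHeads (S : Finset (List (Fin F.M) × Fin F.M)) : Set F.Sample :=
  {ω | ∀ x ∈ S, ω x.1 x.2 = true}

theorem allHeads_inter (S S' : Finset (List (Fin F.M) × Fin F.M)) :
    F.allHeads S ∩ F.allHeads S' = F.allHeads (S ∪ S') := by
  ext ω
  simp only [allHeads, Set.mem_inter_iff, Set.mem_ofPred_eq, Finset.mem_union]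
  exact ⟨fun h x hx => hx.elim (h.1 x) (h.2 x), fun h => ⟨fun x hx => h x (.inl hx),
    fun x hx => h x (.inr hx)⟩⟩

theorem measurableSet_allHeads (S : Finset (List (Fin F.M) × Fin F.M)) :
    MeasurableSet (F.allHeads S) := by
  have : F.allHeads S = ⋂ x ∈ S, (fun ω : F.Sample => ω x.1 x.2) ⁻¹' {true} := by
    ext ω; simp [allHeads]
  rw [this]
  refine Finset.measurableSet_biInter _ fun x _ => ?_
  exact ((measurable_pi_apply x.2).comp (measurable_pi_apply x.1)) (measurableSet_singleton _)

theorem law_allHeads (p : unitInterval) (S : Finset (List (Fin F.M) × Fin F.M)) :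
    (F.law p).real (F.allHeads S) = (p : ℝ) ^ S.card := by
  classical
  have hset : F.allHeads S = Set.pi (S.image Prod.fst : Finset _) fun w =>
      Set.pi Set.univ fun i => if (w, i) ∈ S then {true} else Set.univ := by
    ext ω
    simp only [allHeads, Set.mem_ofPred_eq, Set.mem_pi, Finset.mem_coe, Finset.mem_image,
      Set.mem_univ, true_imp_iff]
    constructor
    · intro h w _ i
      split_ifs with hi
      · exact h _ hi
      · trivial
    · intro h x hx
      simpa [hx] using h x.1 ⟨x, hx, rfl⟩ x.2
  have hm : ∀ w : List (Fin F.M), MeasurableSet (Set.pi Set.univ fun i : Fin F.M =>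
      if (w, i) ∈ S then ({true} : Set Bool) else Set.univ) :=
    fun w => MeasurableSet.univ_pi fun i => MeasurableSet.of_discrete
  rw [hset, law, measureReal_def, Measure.infinitePi_pi _ fun w _ => hm w]
  simp only [Measure.pi_pi]
  rw [← Finset.prod_product' (S.image Prod.fst) Finset.univ (fun w i =>
    (ProbabilityTheory.bernoulliMeasure true false p)
      (if (w, i) ∈ S then ({true} : Set Bool) else Set.univ))]
  have hval : ∀ x : List (Fin F.M) × Fin F.M,
      (ProbabilityTheory.bernoulliMeasure true false p)
        (if (x.1, x.2) ∈ S then ({true} : Set Bool) else Set.univ)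
      = if x ∈ S then (unitInterval.toNNReal p : ENNReal) else 1 := by
    intro x
    split_ifs
    · rw [ProbabilityTheory.bernoulliMeasure_apply _ (measurableSet_singleton _)]
      simp
    · exact measure_univ
  rw [Finset.prod_congr rfl fun x _ => hval x, ← Finset.prod_filter, Finset.prod_const]
  have : (S.image Prod.fst ×ˢ Finset.univ).filter (· ∈ S) = S := by
    ext x
    simp only [Finset.mem_filter, Finset.mem_product, Finset.mem_univ, and_true,
      and_iff_right_iff_imp]
    exact Finset.mem_image_of_mem _
  rw [this]
  simp

/-- The event that one of the words `words n c V` is retained. -/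
def hits (n c : ℕ) (V : F.basicTypes) : Set F.Sample :=
  ⋃ w ∈ F.words n c V, F.allHeads (F.coins w)

theorem measurableSet_hits (n c : ℕ) (V : F.basicTypes) : MeasurableSet (F.hits n c V) :=
  Finset.measurableSet_biUnion _ fun _ _ => F.measurableSet_allHeads _

theorem mem_hits {n c : ℕ} {V : F.basicTypes} {ω : F.Sample} :
    ω ∈ F.hits n c V ↔ ∃ w ∈ F.words n c V, w ∈ F.retained ω n := by
  simp only [hits, Set.mem_iUnion, mem_retained_iff, exists_prop]
  exact exists_congr fun w => and_congr_right fun hw =>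
    ⟨fun h => ⟨F.length_of_mem_words hw, h⟩, fun h => h.2⟩

/-- The second moment bound for the probability of a hit. -/
theorem inv_energy_le_law_hits {p : unitInterval} (hp : 0 < (p : ℝ))
    (hcs : ∀ a V, 0 < F.colSum a V) (n c : ℕ) (V : F.basicTypes) :
    (F.energy p n c)⁻¹ ≤ (F.law p).real (F.hits n c V) := by
  set u := F.expCount p n c V with hu
  have hu0 : 0 < u := F.expCount_pos hp hcs n c V
  set E := F.energy p n c
  have hE : 0 < E := one_pos.trans_le (F.one_le_energy hp n c)
  let one : F.Sample → ℝ := fun _ => 1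
  let ind : Finset (List (Fin F.M) × Fin F.M) → F.Sample → ℝ :=
    fun S => (F.allHeads S).indicator one
  have hind : ∀ S, Integrable (ind S) (F.law p) := fun S =>
    (integrable_const 1).indicator (F.measurableSet_allHeads S)
  have hint : ∀ S, ∫ ω, ind S ω ∂F.law p = (p : ℝ) ^ S.card := by
    intro S
    rw [← law_allHeads]
    exact integral_indicator_one (F.measurableSet_allHeads S)
  let Y : F.Sample → ℝ := fun ω => ∑ w ∈ F.words n c V, ind (F.coins w) ω
  let Z : F.Sample → ℝ := fun ω => ∑ w ∈ F.words n c V, ∑ w' ∈ F.words n c V,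
    ind (F.coins w ∪ F.coins w') ω
  have hYZ : ∀ ω, Z ω = Y ω ^ 2 := by
    intro ω
    simp only [Y, Z, sq, Finset.sum_mul_sum, ind, ← allHeads_inter, one]
    refine Finset.sum_congr rfl fun w _ => Finset.sum_congr rfl fun w' _ => ?_
    by_cases h1 : ω ∈ F.allHeads (F.coins w) <;> by_cases h2 : ω ∈ F.allHeads (F.coins w') <;>
      simp [h1, h2]
  have hYint : Integrable Y (F.law p) := integrable_finsetSum _ fun w _ => hind _
  have hZint : Integrable Z (F.law p) :=
    integrable_finsetSum _ fun w _ => integrable_finsetSum _ fun w' _ => hind _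
  have hEY : ∫ ω, Y ω ∂F.law p = u := by
    rw [integral_finsetSum _ fun w _ => hind _]
    simp only [hint]
    rw [Finset.sum_congr rfl fun w hw => by rw [F.card_coins, F.length_of_mem_words hw],
      Finset.sum_const, nsmul_eq_mul, hu, expCount, mul_comm]
  have hEZ : ∫ ω, Z ω ∂F.law p ≤ u * u * E := by
    rw [integral_finsetSum _ fun w _ => integrable_finsetSum _ fun w' _ => hind _]
    simp only [integral_finsetSum _ fun w' _ => hind _, hint]
    exact F.sum_pow_card_coins_le hp p.2.2 hcs n c V V
  -- With `t = (u * E)⁻¹`, `2 * t * Y - t ^ 2 * Y ^ 2` is at most 1, and it vanishes where `Y = 0`.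
  -- This `t` maximises `2 * t * u - t ^ 2 * u ^ 2 * E`, with value `E⁻¹`.
  have hle : ∀ ω, 2 * (u * E)⁻¹ * Y ω - (u * E)⁻¹ ^ 2 * Z ω
      ≤ (F.hits n c V).indicator one ω := by
    intro ω
    rw [hYZ]
    by_cases h : ω ∈ F.hits n c V
    · rw [Set.indicator_of_mem h]
      have := sq_nonneg (1 - (u * E)⁻¹ * Y ω)
      simp only [one]
      nlinarith
    · rw [Set.indicator_of_notMem h]
      have : Y ω = 0 := by
        refine Finset.sum_eq_zero fun w hw => Set.indicator_of_notMem (fun h' => h ?_) _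
        exact Set.mem_biUnion hw h'
      simp [this]
  have hmain := integral_mono (μ := F.law p)
    ((hYint.const_mul (2 * (u * E)⁻¹)).sub (hZint.const_mul ((u * E)⁻¹ ^ 2)))
    ((integrable_const 1).indicator (F.measurableSet_hits n c V)) hle
  simp only [Pi.sub_apply] at hmain
  rw [integral_sub (hYint.const_mul _) (hZint.const_mul _), integral_const_mul,
    integral_const_mul, hEY] at hmain
  have hone : ∫ ω, (F.hits n c V).indicator (fun _ => (1 : ℝ)) ω ∂F.law p
      = (F.law p).real (F.hits n c V) := integral_indicator_one (F.measurableSet_hits n c V)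
  rw [hone] at hmain
  have h2 : (u * E)⁻¹ ^ 2 * ∫ ω, Z ω ∂F.law p ≤ (u * E)⁻¹ ^ 2 * (u * u * E) := by gcongr
  have h3 : 2 * (u * E)⁻¹ * u - (u * E)⁻¹ ^ 2 * (u * u * E) = E⁻¹ := by
    field_simp
    ring
  linarith

/-! ### Geometry of the approximations -/

/-- The integer `τ` with `f_w(x) = (x + L τ) / L ^ n`. -/
def shiftInt (w : List (Fin F.M)) : ℤ := w.foldl (fun s i => F.L * s + F.t i) 0

theorem wordMap_append {ι : Type*} (g : ι → ℝ → ℝ) (v w : List ι) (x : ℝ) :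
    wordMap g (v ++ w) x = wordMap g v (wordMap g w x) := by
  induction v with
  | nil => rfl
  | cons i v ih => simp [wordMap, ih]

theorem wordMap_map_eq (w : List (Fin F.M)) (x : ℝ) :
    wordMap F.map w x = (x + F.L * F.shiftInt w) / (F.L : ℝ) ^ w.length := by
  have hL : (F.L : ℝ) ≠ 0 := by exact_mod_cast F.L_pos.ne'
  induction w using List.reverseRecOn generalizing x with
  | nil => simp [wordMap, shiftInt]
  | append_singleton w i ih =>
    rw [wordMap_append, ih]
    simp only [wordMap, Function.comp_apply, id, map, shiftInt, List.foldl_append,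
      List.foldl_cons, List.foldl_nil, List.length_append, List.length_singleton]
    push_cast
    field_simp
    ring

/-- Modulo `L ^ n`, the position of `f_w(J^V)` on the grid of mesh `L / L ^ n` is the address `c`,
so words with different addresses have disjoint images up to endpoints. -/
theorem exists_shiftInt_eq {n c : ℕ} (hc : c < F.L ^ n) {V : F.basicTypes}
    {w : List (Fin F.M)} (hw : w ∈ F.words n c V) :
    ∃ l : F.basicTypes, (V : ℤ) + F.shiftInt w = l * (F.L : ℤ) ^ n + c := by
  induction n generalizing c V w with
  | zero =>
    simp only [words, Finset.mem_singleton] at hw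
    subst hw
    exact ⟨V, by simp at hc; simp [shiftInt, hc]⟩
  | succ n ih =>
    simp only [words, Finset.mem_biUnion, Finset.mem_image] at hw
    obtain ⟨x, hx, v, hv, rfl⟩ := hw
    obtain ⟨l, hl⟩ := ih (Nat.div_lt_of_lt_mul (by rwa [pow_succ'] at hc)) hv
    refine ⟨l, ?_⟩
    have h1 := F.mem_steps.1 hx
    have h2 : (c : ℤ) = F.L * (c / F.L : ℕ) + (c % F.L : ℕ) := by
      exact_mod_cast (Nat.div_add_mod c F.L).symm
    simp only [shiftInt, List.foldl_append, List.foldl_cons, List.foldl_nil]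
    rw [shiftInt] at hl
    rw [h2, pow_succ]
    linear_combination h1 + (F.L : ℤ) * hl

/-- The `n`-th approximation of the random set, starting from the set `J`. -/
def approx (ω : F.Sample) (J : Set ℝ) (n : ℕ) : Set ℝ :=
  ⋃ w ∈ F.retained ω n, wordMap F.map w '' J

theorem continuous_wordMap (w : List (Fin F.M)) : Continuous (wordMap F.map w) := by
  have : wordMap F.map w = fun x => (x + F.L * F.shiftInt w) / (F.L : ℝ) ^ w.length :=
    funext fun x => F.wordMap_map_eq w x
  rw [this]
  fun_prop

theorem finite_retained (ω : F.Sample) (n : ℕ) : (F.retained ω n).Finite :=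
  (List.finite_length_eq (Fin F.M) n).subset fun w hw => ((F.mem_retained_iff ω n w).1 hw).1

theorem isCompact_approx (ω : F.Sample) {J : Set ℝ} (hJ : IsCompact J) (n : ℕ) :
    IsCompact (F.approx ω J n) :=
  (F.finite_retained ω n).isCompact_biUnion fun w _ => hJ.image (F.continuous_wordMap w)

theorem antitone_approx (ω : F.Sample) {J : Set ℝ} (hJ : ∀ i, Set.MapsTo (F.map i) J J) :
    Antitone (F.approx ω J) := by
  refine antitone_nat_of_succ_le fun n => ?_
  intro x hx
  simp only [approx, Set.mem_iUnion] at hx ⊢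
  obtain ⟨_, ⟨w, hw, k, -, rfl⟩, y, hy, rfl⟩ := hx
  refine ⟨w, hw, F.map k y, hJ k hy, ?_⟩
  rw [wordMap_append]
  rfl

theorem t_le_last (i : Fin F.M) :
    F.t i ≤ F.t ⟨F.M - 1, Nat.sub_lt F.M_pos Nat.one_pos⟩ :=
  F.t_mono (by rw [Fin.le_def]; have := i.2; simp; omega)

theorem mapsTo_spanInterval (i : Fin F.M) :
    Set.MapsTo (F.map i) F.spanInterval F.spanInterval := by
  have hL := F.one_lt_L_real
  have hL1 : (0 : ℝ) < F.L - 1 := by linarith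
  rintro x ⟨h0, h1⟩
  have ht : (F.t i : ℝ) ≤ F.t ⟨F.M - 1, Nat.sub_lt F.M_pos Nat.one_pos⟩ := by
    exact_mod_cast F.t_le_last i
  refine ⟨by unfold map; positivity, ?_⟩
  have h2 : x / F.L ≤ F.t ⟨F.M - 1, Nat.sub_lt F.M_pos Nat.one_pos⟩ / ((F.L : ℝ) - 1) := by
    rw [div_le_iff₀ (by linarith)]
    refine h1.trans (le_of_eq ?_)
    ring
  unfold map
  calc x / F.L + F.t i
      ≤ F.t ⟨F.M - 1, Nat.sub_lt F.M_pos Nat.one_pos⟩ / ((F.L : ℝ) - 1)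
        + F.t ⟨F.M - 1, Nat.sub_lt F.M_pos Nat.one_pos⟩ := add_le_add h2 ht
    _ = _ := by field_simp; ring

theorem zero_mem_spanInterval : (0 : ℝ) ∈ F.spanInterval := by
  have hL1 : (0 : ℝ) < F.L - 1 := by linarith [F.one_lt_L_real]
  exact ⟨le_rfl, by positivity⟩

/-- The approximations may start from any bounded interval: images of its points under words of
length `n` lie within `R / L ^ n` of images of `0`, which belongs to `spanInterval`. -/
theorem iInter_approx_subset (ω : F.Sample) (R : ℝ) :
    ⋂ n, F.approx ω (Set.Icc (-R) R) n ⊆ F.randomSet ω := by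
  intro x hx
  simp only [randomSet, Set.mem_iInter]
  intro m _
  change x ∈ F.approx ω F.spanInterval m
  have hcl := (F.isCompact_approx ω (J := F.spanInterval) isCompact_Icc m).isClosed
  have hex : ∀ n, ∃ z ∈ F.approx ω F.spanInterval n, |x - z| ≤ R * (1 / (F.L : ℝ)) ^ n := by
    intro n
    have hn := Set.mem_iInter.1 hx n
    simp only [approx, Set.mem_iUnion] at hn
    obtain ⟨w, hw, y, hy, rfl⟩ := hn
    refine ⟨wordMap F.map w 0, Set.mem_biUnion hw ⟨0, F.zero_mem_spanInterval, rfl⟩, ?_⟩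
    have hl := ((F.mem_retained_iff ω n w).1 hw).1
    rw [wordMap_map_eq, wordMap_map_eq, ← sub_div, add_sub_add_right_eq_sub, sub_zero, abs_div,
      abs_of_nonneg (by positivity : (0 : ℝ) ≤ (F.L : ℝ) ^ w.length), hl, div_eq_mul_inv,
      one_div, inv_pow]
    gcongr
    exact abs_le.2 hy
  choose z hz hxz using hex
  refine hcl.mem_of_tendsto (b := Filter.atTop) (f := z) ?_ ?_
  · rw [tendsto_iff_dist_tendsto_zero]
    have hlim : Filter.Tendsto (fun n => R * (1 / (F.L : ℝ)) ^ n) Filter.atTop (nhds 0) := by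
      have h1 : 1 / (F.L : ℝ) < 1 := by
        rw [div_lt_one (by linarith [F.one_lt_L_real])]
        exact F.one_lt_L_real
      simpa using (tendsto_pow_atTop_nhds_zero_of_lt_one (by positivity) h1).const_mul R
    refine squeeze_zero (fun _ => dist_nonneg) (fun n => ?_) hlim
    rw [dist_comm]
    exact hxz n
  · filter_upwards [Filter.eventually_ge_atTop m] with n hn
    exact F.antitone_approx ω F.mapsTo_spanInterval hn (hz n)

open Classical in
/-- The addresses at which a word is retained account for a proportional volume. -/
theorem card_hits_le_volume_approx (ω : F.Sample) (V : F.basicTypes) {R : ℝ}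
    (hR : F.bigInterval V ⊆ Set.Icc (-R) R) (n : ℕ) :
    (((Finset.range (F.L ^ n)).filter fun c => ω ∈ F.hits n c V).card : ENNReal)
        * ENNReal.ofReal (F.L / (F.L : ℝ) ^ n)
      ≤ volume (F.approx ω (Set.Icc (-R) R) n) := by
  have hL : (0 : ℝ) < F.L := by exact_mod_cast F.L_pos
  set B := (Finset.range (F.L ^ n)).filter fun c => ω ∈ F.hits n c V with hB
  have hex : ∀ c, ∃ w, c ∈ B → w ∈ F.words n c V ∧ w ∈ F.retained ω n := by
    intro c
    by_cases h : c ∈ B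
    · obtain ⟨w, h1, h2⟩ := F.mem_hits.1 (Finset.mem_filter.1 h).2
      exact ⟨w, fun _ => ⟨h1, h2⟩⟩
    · exact ⟨[], fun h' => (h h').elim⟩
  choose w hw using hex
  let j : ℕ → ℤ := fun c => V + F.shiftInt (w c)
  have hlt : ∀ c ∈ B, c < F.L ^ n := fun c hc => Finset.mem_range.1 (Finset.mem_filter.1 hc).1
  have hj : ∀ c ∈ B, j c % (F.L : ℤ) ^ n = c := by
    intro c hc
    obtain ⟨l, hl⟩ := F.exists_shiftInt_eq (hlt c hc) (hw c hc).1
    simp only [j, hl]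
    rw [add_comm, Int.add_mul_emod_self_right]
    exact Int.emod_eq_of_lt (by positivity) (by exact_mod_cast hlt c hc)
  -- Half-open pieces make disjointness exact.
  let I : ℕ → Set ℝ := fun c => Set.Ico (j c * (F.L / (F.L : ℝ) ^ n))
    ((j c + 1) * (F.L / (F.L : ℝ) ^ n))
  have hs : (0 : ℝ) < F.L / (F.L : ℝ) ^ n := by positivity
  have hdisj : (B : Set ℕ).PairwiseDisjoint I := by
    intro c hc c' hc' hne
    rw [Function.onFun, Set.disjoint_left]
    rintro x ⟨h1, h2⟩ ⟨h3, h4⟩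
    refine hne ?_
    have h5 : (j c : ℝ) < j c' + 1 := lt_of_mul_lt_mul_right (h1.trans_lt h4) hs.le
    have h6 : (j c' : ℝ) < j c + 1 := lt_of_mul_lt_mul_right (h3.trans_lt h2) hs.le
    have h7 : j c = j c' := by
      have h5' : j c < j c' + 1 := by exact_mod_cast h5
      have h6' : j c' < j c + 1 := by exact_mod_cast h6
      omega
    have h8 := hj c hc
    rw [h7, hj c' hc'] at h8
    exact_mod_cast h8.symm
  have hvol : volume (⋃ c ∈ B, I c) = (B.card : ENNReal) * ENNReal.ofReal (F.L / (F.L : ℝ) ^ n) := by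
    rw [measure_biUnion_finset hdisj fun c _ => measurableSet_Ico]
    have : ∀ c ∈ B, volume (I c) = ENNReal.ofReal (F.L / (F.L : ℝ) ^ n) := by
      intro c _
      rw [Real.volume_Ico]
      congr 1
      ring
    rw [Finset.sum_congr rfl this, Finset.sum_const, nsmul_eq_mul]
  rw [← hvol]
  refine measure_mono (Set.iUnion₂_subset fun c hc x hx => ?_)
  obtain ⟨hw1, hw2⟩ := hw c hc
  refine Set.mem_biUnion hw2 ?_
  have hl := F.length_of_mem_words hw1
  obtain ⟨h1, h2⟩ := hx
  have hLn : (0 : ℝ) < (F.L : ℝ) ^ n := by positivity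
  rw [← mul_div_assoc, div_le_iff₀ hLn] at h1
  rw [← mul_div_assoc, lt_div_iff₀ hLn] at h2
  simp only [j] at h1 h2
  push_cast at h1 h2
  refine ⟨x * (F.L : ℝ) ^ n - F.L * F.shiftInt (w c), hR ⟨?_, ?_⟩, ?_⟩
  · linarith
  · linarith
  · rw [wordMap_map_eq, hl]
    field_simp
    ring

theorem exists_invariant_Icc (V : F.basicTypes) :
    ∃ R : ℝ, F.bigInterval V ⊆ Set.Icc (-R) R ∧
      ∀ i, Set.MapsTo (F.map i) (Set.Icc (-R) R) (Set.Icc (-R) R) := by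
  set T : ℝ := ((F.t ⟨F.M - 1, Nat.sub_lt F.M_pos Nat.one_pos⟩ : ℕ) : ℝ)
  have hT0 : 0 ≤ T := Nat.cast_nonneg _
  set v : ℝ := ((V : ℤ) : ℝ)
  have hL : (2 : ℝ) ≤ F.L := by exact_mod_cast F.two_le_L
  -- The maps at least halve absolute values before translating by at most `T`, and `T ≤ R / 2`; the
  -- second summand makes room for `J^V`.
  set R := 2 * T + (|v| + 1) * F.L with hR
  have hR0 : 0 ≤ R := by positivity
  refine ⟨R, fun x hx => ?_, fun i x hx => ?_⟩
  · obtain ⟨h1, h2⟩ := hx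
    have h3 : -(|v| * F.L) ≤ v * F.L := by
      rw [← neg_mul]; gcongr; exact neg_abs_le v
    have h4 : (v + 1) * F.L ≤ (|v| + 1) * F.L := by gcongr; exact le_abs_self v
    constructor <;> nlinarith
  · have ht : (F.t i : ℝ) ≤ T := Nat.cast_le.2 (F.t_le_last i)
    have ht0 : (0 : ℝ) ≤ F.t i := Nat.cast_nonneg _
    have h1 : |x / F.L| ≤ R / 2 := by
      rw [abs_div, abs_of_pos (by linarith : (0 : ℝ) < F.L)]
      exact div_le_div₀ hR0 (abs_le.2 hx) (by norm_num) hL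
    have h2 : 2 * T ≤ R := by rw [hR]; have : 0 ≤ (|v| + 1) * F.L := by positivity
                              linarith
    have h3 := abs_le.1 h1
    unfold map
    constructor <;> linarith

/-! ### Positive measure with positive probability -/

/-- The random set has positive Lebesgue measure with positive probability. -/
theorem not_ae_volume_randomSet_eq_zero [Nonempty F.basicTypes] {p : unitInterval}
    (hp : 0 < (p : ℝ))
    (hcol : ∀ U : F.basicTypes, 1 < (p : ℝ) ^ F.L * ∏ a : Fin F.L, (F.colSum a U : ℝ)) :
    ¬ ∀ᵐ ω ∂F.law p, volume (F.randomSet ω) = 0 := by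
  classical
  intro hae
  obtain ⟨V⟩ := ‹Nonempty F.basicTypes›
  have : Nonempty F.basicTypes := ⟨V⟩
  have hL : (0 : ℝ) < F.L := by exact_mod_cast F.L_pos
  obtain ⟨δ, hδ, hsum⟩ := F.exists_le_sum_inv_energy hp hcol
  obtain ⟨R, hR, hRmap⟩ := F.exists_invariant_Icc V
  -- `X n` is the proportion of addresses of generation `n` that are hit.
  let X : ℕ → F.Sample → ℝ := fun n ω => ((F.L : ℝ) ^ n)⁻¹ *
    ∑ c ∈ Finset.range (F.L ^ n), (F.hits n c V).indicator (fun _ => (1 : ℝ)) ω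
  have hind : ∀ n c, Integrable ((F.hits n c V).indicator fun _ => (1 : ℝ)) (F.law p) :=
    fun n c => (integrable_const 1).indicator (F.measurableSet_hits n c V)
  have hXint : ∀ n, Integrable (X n) (F.law p) := fun n =>
    (integrable_finsetSum _ fun c _ => hind n c).const_mul _
  have hXlow : ∀ n, δ ≤ ∫ ω, X n ω ∂F.law p := by
    intro n
    simp only [X]
    rw [integral_const_mul, integral_finsetSum _ fun c _ => hind n c, inv_mul_eq_div,
      le_div_iff₀ (by positivity)]
    refine (hsum n).trans (Finset.sum_le_sum fun c _ => ?_)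
    have h1 : ∫ ω, (F.hits n c V).indicator (fun _ => (1 : ℝ)) ω ∂F.law p
        = (F.law p).real (F.hits n c V) := integral_indicator_one (F.measurableSet_hits n c V)
    rw [h1]
    refine F.inv_energy_le_law_hits hp (fun a U => ?_) n c V
    by_contra h
    have h0 : (F.colSum a U : ℝ) = 0 := by exact_mod_cast (by omega : F.colSum a U = 0)
    have := hcol U
    rw [Finset.prod_eq_zero (Finset.mem_univ a) h0] at this
    linarith
  have hcard : ∀ n ω, X n ω = ((F.L : ℝ) ^ n)⁻¹ *
      ((Finset.range (F.L ^ n)).filter fun c => ω ∈ F.hits n c V).card := by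
    intro n ω
    simp only [X, Set.indicator_apply, Finset.sum_boole]
  have hX0 : ∀ n ω, 0 ≤ X n ω := fun n ω => by rw [hcard]; positivity
  have hX1 : ∀ n ω, X n ω ≤ 1 := by
    intro n ω
    rw [hcard, inv_mul_le_iff₀ (by positivity), mul_one]
    have := Finset.card_filter_le (Finset.range (F.L ^ n)) fun c => ω ∈ F.hits n c V
    rw [Finset.card_range] at this
    exact_mod_cast this
  have hlim : ∀ᵐ ω ∂F.law p, Filter.Tendsto (fun n => X n ω) Filter.atTop (nhds 0) := by
    filter_upwards [hae] with ω hω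
    have hcomp := F.isCompact_approx ω (J := Set.Icc (-R) R) isCompact_Icc
    have h1 := tendsto_measure_iInter_atTop (μ := volume)
      (fun n => (hcomp n).measurableSet.nullMeasurableSet) (F.antitone_approx ω hRmap)
      ⟨0, (hcomp 0).measure_lt_top.ne⟩
    rw [measure_mono_null (F.iInter_approx_subset ω R) hω] at h1
    have h2 := (ENNReal.tendsto_toReal ENNReal.zero_ne_top).comp h1
    have h3 := h2.div_const (F.L : ℝ)
    simp only [ENNReal.toReal_zero, zero_div] at h3
    refine squeeze_zero (fun n => hX0 n ω) (fun n => ?_) h3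
    have h4 := ENNReal.toReal_mono (hcomp n).measure_lt_top.ne
      (F.card_hits_le_volume_approx ω V hR n)
    rw [ENNReal.toReal_mul, ENNReal.toReal_ofReal (by positivity), ENNReal.toReal_natCast] at h4
    rw [le_div_iff₀ hL, hcard]
    refine le_trans (le_of_eq ?_) h4
    ring
  have hI := tendsto_integral_of_dominated_convergence (fun _ => (1 : ℝ))
    (fun n => (hXint n).aestronglyMeasurable) (integrable_const 1)
    (fun n => Filter.Eventually.of_forall fun ω => by
      rw [Real.norm_of_nonneg (hX0 n ω)]; exact hX1 n ω) hlim
  rw [integral_zero] at hI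
  exact absurd (ge_of_tendsto' hI hXlow) (not_le.2 hδ)

/-! ### The branching structure of the law -/

/-- The coin tosses seen from the `i`-th child of the root. -/
def childSample (i : Fin F.M) (ω : F.Sample) : F.Sample := fun w => ω (i :: w)

/-- The sample with given coins at the root and given subtrees. -/
def graft (z : (Fin F.M → Bool) × (Fin F.M → F.Sample)) : F.Sample
  | [] => z.1
  | i :: w => z.2 i w

theorem measurable_graft : Measurable F.graft := by
  refine measurable_pi_lambda _ fun w => ?_
  cases w with
  | nil => exact measurable_fst
  | cons i w =>
    exact (measurable_pi_apply w).comp ((measurable_pi_apply i).comp measurable_snd)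

theorem _root_.Finset.prod_list_eq {ι β : Type*} [Fintype ι] [DecidableEq ι] [CommMonoid β]
    (s : Finset (List ι)) (f : List ι → β) :
    ∏ w ∈ s, f w = (if [] ∈ s then f [] else 1) *
      ∏ i, ∏ w ∈ s.preimage (List.cons i) List.cons_injective.injOn, f (i :: w) := by
  have h1 : ∏ i, ∏ w ∈ s.preimage (List.cons i) List.cons_injective.injOn, f (i :: w)
      = ∏ w ∈ s.erase [], f w := by
    have hs : s.erase [] = Finset.univ.biUnion fun i =>
        (s.preimage (List.cons i) List.cons_injective.injOn).image (List.cons i) := by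
      ext w
      cases w <;> simp
    rw [hs, Finset.prod_biUnion]
    · refine Finset.prod_congr rfl fun i _ => ?_
      rw [Finset.prod_image List.cons_injective.injOn]
    · intro i _ j _ hij
      rw [Function.onFun, Finset.disjoint_left]
      intro w hw hw'
      obtain ⟨v, _, rfl⟩ := Finset.mem_image.1 hw
      obtain ⟨v', _, h⟩ := Finset.mem_image.1 hw'
      exact hij (List.cons.inj h).1.symm
  rw [h1]
  split_ifs with h
  · exact (Finset.mul_prod_erase s f h).symm
  · rw [Finset.erase_eq_of_notMem h, one_mul]

/-- Independence of the root coins and the `M` subtrees, checked on cylinders by sorting words by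
first letter. -/
theorem map_graft (p : unitInterval) :
    ((Measure.pi fun _ : Fin F.M => ProbabilityTheory.bernoulliMeasure true false p).prod
      (Measure.pi fun _ : Fin F.M => F.law p)).map F.graft = F.law p := by
  classical
  refine Measure.eq_infinitePi _ fun s t ht => ?_
  rw [Measure.map_apply F.measurable_graft
    (MeasurableSet.pi (Finset.countable_toSet s) fun w _ => ht w)]
  have hpre : F.graft ⁻¹' Set.pi s t =
      (if [] ∈ s then t [] else Set.univ) ×ˢ Set.pi Set.univ fun i =>
        Set.pi (s.preimage (List.cons i) List.cons_injective.injOn : Finset _)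
          fun w => t (i :: w) := by
    ext z
    simp only [Set.mem_preimage, Set.mem_pi, Finset.mem_coe, Set.mem_prod, Set.mem_univ,
      true_imp_iff, Finset.mem_preimage]
    constructor
    · intro h
      refine ⟨?_, fun i w hw => h (i :: w) hw⟩
      split_ifs with h0
      · exact h [] h0
      · trivial
    · rintro ⟨h1, h2⟩ w hw
      cases w with
      | nil => rw [if_pos hw] at h1; exact h1
      | cons i w => exact h2 i w hw
  rw [hpre, Measure.prod_prod, Measure.pi_pi, Finset.prod_list_eq]
  congr 1
  · split_ifs
    · rfl
    · exact measure_univ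
  · refine Finset.prod_congr rfl fun i _ => ?_
    exact Measure.infinitePi_pi _ fun w _ => ht (i :: w)

/-- The probability that every retained child of the root has a property `B` of its subtree. -/
theorem law_forall_child (p : unitInterval) {B : Set F.Sample} (hB : MeasurableSet B) :
    (F.law p).real {ω | ∀ i, ω [] i = true → F.childSample i ω ∈ B}
      = (1 - p + p * (F.law p).real B) ^ F.M := by
  classical
  have hC : MeasurableSet {ω : F.Sample | ∀ i, ω [] i = true → F.childSample i ω ∈ B} := by
    have : {ω : F.Sample | ∀ i, ω [] i = true → F.childSample i ω ∈ B}
        = ⋂ i, ((fun ω : F.Sample => ω [] i) ⁻¹' {true})ᶜ ∪ F.childSample i ⁻¹' B := by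
      ext ω
      simp [imp_iff_not_or]
    rw [this]
    refine MeasurableSet.iInter fun i => MeasurableSet.union ?_ ?_
    · exact (((measurable_pi_apply i).comp (measurable_pi_apply []))
        (measurableSet_singleton true)).compl
    · exact (measurable_pi_lambda _ fun w => measurable_pi_apply (i :: w)) hB
  -- `D` is the condition on one child: its coin fails, or its subtree lies in `B`. The `M` pairs of
  -- coin and subtree are independent.
  let D : Set (Bool × F.Sample) := {false} ×ˢ Set.univ ∪ {true} ×ˢ B
  have hD : MeasurableSet D := ((measurableSet_singleton _).prod MeasurableSet.univ).union
    ((measurableSet_singleton _).prod hB)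
  have hmp := measurePreserving_arrowProdEquivProdArrow Bool F.Sample (Fin F.M)
    (fun _ => ProbabilityTheory.bernoulliMeasure true false p) (fun _ => F.law p)
  have hDval : ((ProbabilityTheory.bernoulliMeasure true false p).prod (F.law p)).real D
      = 1 - p + p * (F.law p).real B := by
    rw [measureReal_union _ ((measurableSet_singleton _).prod hB), measureReal_prod_prod,
      measureReal_prod_prod, ProbabilityTheory.bernoulliMeasure_real_apply _
        (measurableSet_singleton _), ProbabilityTheory.bernoulliMeasure_real_apply _
        (measurableSet_singleton _)]
    · simp
    · rw [Set.disjoint_left]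
      rintro ⟨b, η⟩ ⟨h1, _⟩ ⟨h2, _⟩
      simp at h1 h2
      simp [h1] at h2
  rw [← hDval, measureReal_def]
  nth_rewrite 1 [← F.map_graft p]
  rw [Measure.map_apply F.measurable_graft hC, ← hmp.map_eq,
    Measure.map_apply hmp.measurable (F.measurable_graft hC)]
  have hset : (MeasurableEquiv.arrowProdEquivProdArrow Bool F.Sample (Fin F.M)) ⁻¹'
      (F.graft ⁻¹' {ω | ∀ i, ω [] i = true → F.childSample i ω ∈ B})
      = Set.pi Set.univ fun _ => D := by
    ext z
    simp only [Set.mem_preimage, Set.mem_ofPred_eq, Set.mem_pi, Set.mem_univ, true_imp_iff]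
    refine forall_congr' fun i => ?_
    change ((z i).1 = true → (z i).2 ∈ B) ↔ z i ∈ D
    rcases h : z i with ⟨b, η⟩
    cases b <;> simp [D]
  rw [hset, Measure.pi_pi, Finset.prod_const, Finset.card_univ, Fintype.card_fin,
    ENNReal.toReal_pow]
  rfl

theorem cons_mem_retained_iff (ω : F.Sample) (n : ℕ) (i : Fin F.M) (w : List (Fin F.M)) :
    i :: w ∈ F.retained ω (n + 1) ↔
      ω [] i = true ∧ w ∈ F.retained (F.childSample i ω) n := by
  induction n generalizing w with
  | zero =>
    simp only [retained, Set.mem_ofPred_eq, Set.mem_singleton_iff]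
    constructor
    · rintro ⟨_, rfl, k, hk, h⟩
      obtain ⟨rfl, rfl⟩ := by simpa using h
      exact ⟨hk, rfl⟩
    · rintro ⟨h, rfl⟩
      exact ⟨[], rfl, i, h, rfl⟩
  | succ n ih =>
    rw [retained, retained]
    simp only [Set.mem_ofPred_eq]
    constructor
    · rintro ⟨v, hv, k, hk, h⟩
      cases v with
      | nil =>
        have := ((F.mem_retained_iff ω (n + 1) []).1 hv).1
        simp at this
      | cons j v =>
        obtain ⟨rfl, rfl⟩ := List.cons.inj h
        exact ⟨((ih v).1 hv).1, v, ((ih v).1 hv).2, k, hk, rfl⟩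
    · rintro ⟨h, v, hv, k, hk, rfl⟩
      exact ⟨i :: v, (ih v).2 ⟨h, hv⟩, k, hk, rfl⟩

theorem seqPrefix_succ {ι : Type*} (s : ℕ → ι) (n : ℕ) :
    seqPrefix s (n + 1) = s 0 :: seqPrefix (fun k => s (k + 1)) n := by
  simp [seqPrefix, List.ofFn_succ]

theorem seqPrefix_succ' {ι : Type*} (s : ℕ → ι) (n : ℕ) :
    seqPrefix s (n + 1) = seqPrefix s n ++ [s n] := by
  rw [seqPrefix, List.ofFn_succ_last]
  rfl

theorem forall_child_extinct_subset :
    {ω | ∀ i, ω [] i = true → F.childSample i ω ∈ F.nonExtinctionᶜ} ⊆ F.nonExtinctionᶜ := by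
  rintro ω hω ⟨s, hs⟩
  have h : ∀ n, ω [] (s 0) = true ∧
      seqPrefix (fun k => s (k + 1)) n ∈ F.retained (F.childSample (s 0) ω) n := by
    intro n
    have := hs (n + 1)
    rwa [seqPrefix_succ, cons_mem_retained_iff] at this
  exact hω (s 0) (h 0).1 ⟨_, fun n => (h n).2⟩

/-- König's lemma, by compactness of the space of infinite words; it makes non-extinction
measurable. -/
theorem nonExtinction_eq :
    F.nonExtinction = ⋂ n, ⋃ w : List (Fin F.M), {ω | w ∈ F.retained ω n} := by
  ext ω
  simp only [Set.mem_iInter, Set.mem_iUnion, Set.mem_ofPred_eq]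
  constructor
  · rintro ⟨s, hs⟩ n
    exact ⟨_, hs n⟩
  · intro h
    let K : ℕ → Set (ℕ → Fin F.M) := fun n => {s | seqPrefix s n ∈ F.retained ω n}
    have hne : (⋂ n, K n).Nonempty := by
      refine IsCompact.nonempty_iInter_of_sequence_nonempty_isCompact_isClosed K ?_ ?_ ?_ ?_
      · intro n s hs
        obtain ⟨v, hv, k, -, hvk⟩ := hs
        rw [seqPrefix_succ'] at hvk
        change seqPrefix s n ∈ F.retained ω n
        rwa [(List.append_inj' hvk rfl).1]
      · intro n
        obtain ⟨w, hw⟩ := h n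
        have hl := ((F.mem_retained_iff ω n w).1 hw).1
        -- The padding letter is immaterial: only the first `n` letters matter.
        refine ⟨fun k => w.getD k ⟨0, F.M_pos⟩, ?_⟩
        change seqPrefix (fun k => w.getD k ⟨0, F.M_pos⟩) n ∈ F.retained ω n
        convert hw
        subst hl
        refine List.ext_getElem (by simp [seqPrefix]) fun k h1 h2 => ?_
        simp [seqPrefix]
      · have : K 0 = Set.univ := by
          ext s
          simp [K, retained, seqPrefix]
        rw [this]
        exact isCompact_univ
      · intro n
        have hcont : Continuous fun (s : ℕ → Fin F.M) (k : Fin n) => s k := by fun_prop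
        exact (isClosed_discrete {f : Fin n → Fin F.M | List.ofFn f ∈ F.retained ω n}).preimage
          hcont
    obtain ⟨s, hs⟩ := hne
    exact ⟨s, fun n => Set.mem_iInter.1 hs n⟩

theorem measurableSet_mem_retained (n : ℕ) (w : List (Fin F.M)) :
    MeasurableSet {ω : F.Sample | w ∈ F.retained ω n} := by
  by_cases h : w.length = n
  · have : {ω : F.Sample | w ∈ F.retained ω n} = F.allHeads (F.coins w) := by
      ext ω
      simp [mem_retained_iff, allHeads, h]
    rw [this]
    exact F.measurableSet_allHeads _
  · have : {ω : F.Sample | w ∈ F.retained ω n} = ∅ := by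
      ext ω
      simp [mem_retained_iff, h]
    rw [this]
    exact MeasurableSet.empty

theorem measurableSet_nonExtinction : MeasurableSet F.nonExtinction := by
  rw [nonExtinction_eq]
  exact MeasurableSet.iInter fun n => MeasurableSet.iUnion fun w =>
    F.measurableSet_mem_retained n w

/-- The graph of the random set is measurable in the product, so the volume of its sections is a
measurable function. -/
theorem measurableSet_volume_randomSet_eq_zero :
    MeasurableSet {ω : F.Sample | volume (F.randomSet ω) = 0} := by
  have hgraph : MeasurableSet {z : F.Sample × ℝ | z.2 ∈ F.randomSet z.1} := by
    have : {z : F.Sample × ℝ | z.2 ∈ F.randomSet z.1} = ⋂ n : ℕ, ⋂ _ : n ≥ 1,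
        ⋃ w : List (Fin F.M), {ω : F.Sample | w ∈ F.retained ω n} ×ˢ
          (wordMap F.map w '' F.spanInterval) := by
      ext z
      simp [randomSet]
    rw [this]
    refine MeasurableSet.iInter fun n => MeasurableSet.iInter fun _ => MeasurableSet.iUnion
      fun w => (F.measurableSet_mem_retained n w).prod ?_
    exact (IsCompact.image isCompact_Icc (F.continuous_wordMap w)).measurableSet
  exact measurable_measure_prodMk_left hgraph (measurableSet_singleton 0)

theorem volume_randomSet_eq_zero_of_extinct {ω : F.Sample} (h : ω ∉ F.nonExtinction) :
    volume (F.randomSet ω) = 0 := by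
  rw [nonExtinction_eq] at h
  simp only [Set.mem_iInter, Set.mem_iUnion, Set.mem_ofPred_eq, not_forall, not_exists] at h
  obtain ⟨n, hn⟩ := h
  have : F.randomSet ω = ∅ := by
    rw [Set.eq_empty_iff_forall_notMem]
    intro x hx
    -- Generation `n + 1` is used because the intersection omits generation 0.
    have hx' := Set.mem_iInter₂.1 hx (n + 1) (by omega)
    simp only [Set.mem_iUnion] at hx'
    obtain ⟨_, ⟨v, hv, -⟩, -⟩ := hx'
    exact hn v hv
  rw [this, measure_empty]

theorem map_mem_randomSet {ω : F.Sample} {i : Fin F.M} (hi : ω [] i = true) {x : ℝ}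
    (hx : x ∈ F.randomSet (F.childSample i ω)) : F.map i x ∈ F.randomSet ω := by
  simp only [randomSet, Set.mem_iInter] at hx ⊢
  intro n hn
  obtain ⟨m, rfl⟩ : ∃ m, n = m + 1 := ⟨n - 1, by omega⟩
  have hx' : x ∈ F.approx (F.childSample i ω) F.spanInterval m :=
    F.antitone_approx _ F.mapsTo_spanInterval (Nat.le_succ m) (hx (m + 1) hn)
  simp only [approx, Set.mem_iUnion] at hx'
  obtain ⟨w, hw, y, hy, rfl⟩ := hx'
  exact Set.mem_biUnion ((F.cons_mem_retained_iff ω m i w).2 ⟨hi, hw⟩) ⟨y, hy, rfl⟩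

/-- A retained child contributes an affine copy of its own random set, so nullity is inherited by
every retained subtree. -/
theorem volume_randomSet_eq_zero_subset :
    {ω : F.Sample | volume (F.randomSet ω) = 0} ⊆
      {ω | ∀ i, ω [] i = true → F.childSample i ω ∈
        {ω : F.Sample | volume (F.randomSet ω) = 0}} := by
  intro ω hω i hi
  have hL : (F.L : ℝ)⁻¹ ≠ 0 := by exact inv_ne_zero (by exact_mod_cast F.L_pos.ne')
  refine measure_mono_null (t := F.map i ⁻¹' F.randomSet ω)
    (fun x hx => F.map_mem_randomSet hi hx) ?_
  have h1 : F.map i ⁻¹' F.randomSet ω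
      = (fun x => x * (F.L : ℝ)⁻¹) ⁻¹' ((fun x => x + (F.t i : ℝ)) ⁻¹' F.randomSet ω) := by
    ext x
    simp [map, div_eq_mul_inv]
  rw [h1, Real.volume_preimage_mul_right hL, measure_preimage_add_right,
    show volume (F.randomSet ω) = 0 from hω, mul_zero]

end IntegerIFS

/-! ### Fixed-point comparison and conclusion -/

/-- The generating function of a binomial law has at most one fixed point below `1`. -/
theorem eq_of_binomial_fixedPoint {p x y : ℝ} {M : ℕ} (hM : 0 < M) (hp0 : 0 < p) (hp1 : p < 1)
    (hx0 : 0 ≤ x) (hxy : x ≤ y) (hy1 : y < 1) (hx : (1 - p + p * x) ^ M ≤ x)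
    (hy : y ≤ (1 - p + p * y) ^ M) : x = y := by
  by_contra hne
  have hlt : x < y := lt_of_le_of_ne hxy hne
  rcases (by omega : M = 1 ∨ 2 ≤ M) with rfl | hM2
  · nlinarith
  have hc : 0 < 1 - x := by linarith
  have ha : 0 < (1 - y) / (1 - x) := div_pos (by linarith) hc
  have hb : 0 < (y - x) / (1 - x) := div_pos (by linarith) hc
  -- These weights write `y` as a convex combination of `x` and 1. Strict convexity then gives `g y
  -- < y`, contradicting `hy`.
  have hab : (1 - y) / (1 - x) + (y - x) / (1 - x) = 1 := by
    rw [← add_div, div_eq_one_iff_eq hc.ne']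
    ring
  have h := (strictConvexOn_pow hM2).2 (x := 1 - p + p * x) (y := 1)
    (by rw [Set.mem_Ici]; nlinarith) (by simp) (by nlinarith) ha hb hab
  simp only [smul_eq_mul, one_pow, mul_one] at h
  have h1 : (1 - y) / (1 - x) * (1 - p + p * x) + (y - x) / (1 - x) = 1 - p + p * y := by
    field_simp
    ring
  have h2 : (1 - y) / (1 - x) * x + (y - x) / (1 - x) = y := by
    field_simp
    ring
  rw [h1] at h
  have h3 := mul_le_mul_of_nonneg_left hx ha.le
  linarith

theorem theoremy25 (F : IntegerIFS) (p : unitInterval)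
    (hp0 : 0 < (p : ℝ)) (hp1 : (p : ℝ) < 1)
    (hcol : ∀ U : F.basicTypes,
      1 < (p : ℝ) ^ F.L * ∏ a : Fin F.L, (F.colSum a U : ℝ))
    (hrow : ∀ b : Fin F.L, ∃ U : F.basicTypes, ∀ V : F.basicTypes, 0 < F.mat b U V) :
    0 < F.law p F.nonExtinction ∧
      ∀ᵐ ω ∂(ProbabilityTheory.cond (F.law p) F.nonExtinction),
        0 < volume (F.randomSet ω) := by
  -- Condition 2 supplies a basic type; without one, condition 1 would be vacuous.
  have : Nonempty F.basicTypes := ⟨(hrow ⟨0, F.L_pos⟩).choose⟩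
  set B : Set F.Sample := {ω | volume (F.randomSet ω) = 0} with hBdef
  have hB : MeasurableSet B := F.measurableSet_volume_randomSet_eq_zero
  have hN := F.measurableSet_nonExtinction
  have hsub : F.nonExtinctionᶜ ⊆ B := fun ω hω => F.volume_randomSet_eq_zero_of_extinct hω
  have hB1 : (F.law p).real B < 1 := by
    refine lt_of_le_of_ne measureReal_le_one fun h => ?_
    refine F.not_ae_volume_randomSet_eq_zero hp0 hcol ?_
    change B ∈ ae (F.law p)
    rw [mem_ae_iff, prob_compl_eq_zero_iff hB, ← ENNReal.toReal_eq_one_iff]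
    exact h
  have heq : (F.law p).real F.nonExtinctionᶜ = (F.law p).real B := by
    refine eq_of_binomial_fixedPoint F.M_pos hp0 hp1 measureReal_nonneg (measureReal_mono hsub)
      hB1 ?_ ?_
    · rw [← F.law_forall_child p hN.compl]
      exact measureReal_mono F.forall_child_extinct_subset
    · rw [← F.law_forall_child p hB]
      exact measureReal_mono F.volume_randomSet_eq_zero_subset
  constructor
  · rw [pos_iff_ne_zero]
    intro h0
    have h1 : (F.law p).real F.nonExtinctionᶜ = 1 := by
      rw [measureReal_def, (prob_compl_eq_one_iff hN).2 h0, ENNReal.toReal_one]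
    rw [← heq, h1] at hB1
    exact lt_irrefl _ hB1
  · have hdiff : (F.law p) (B \ F.nonExtinctionᶜ) = 0 := by
      have := measureReal_sdiff hsub hN.compl (μ := F.law p)
      rw [heq, sub_self] at this
      exact (measureReal_eq_zero_iff).1 this
    refine Measure.ae_smul_measure ?_ _
    rw [ae_restrict_iff' hN]
    filter_upwards [measure_eq_zero_iff_ae_notMem.1 hdiff] with ω hω hωN
    rw [pos_iff_ne_zero]
    exact fun h0 => hω ⟨h0, fun h => h hωN⟩
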